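/- Let $\Omega\subset\mathbb R^3$ be open, $T>0$, $0<\alpha,\beta\le 1$, $\epsilon_s>\epsilon_\infty\ge 1$, $\Delta\epsilon=\epsilon_s-\epsilon_\infty$. Write $(\cdot,\cdot)$ and $\|\cdot\|$ for the inner product and norm of $\boldsymbol L^2(\Omega)=L^2(\Omega;\mathbb R^3)$, let $H(\mathrm{curl};\Omega)=\{v\in \boldsymbol L^2(\Omega):\nabla\times v\in \boldsymbol L^2(\Omega)\}$, and let $H_0(\mathrm{curl};\Omega)$ be the closure of $C_c^\infty(\Omega;\mathbb R^3)$ in its graph norm. Let $(\gamma)_k=\gamma(\gamma+1)\cdots(\gamma+k-1)$ and $$e^{\gamma}_{\rho,\mu}(t;\sigma)=t^{\mu-1}E^{\gamma}_{\rho,\mu}(\sigma t^{\rho}),\qquad E^{\gamma}_{\rho,\mu}(z)=\sum_{k=0}^{\infty}\frac{(\gamma)_k}{\Gamma(\rho k+\mu)}\frac{z^k}{k!}.$$ Consider the rescaled Havriliak–Negami Maxwell system in $\Omega\times(0,T]$, $$\epsilon_\infty\partial_t\boldsymbol E+\partial_t\boldsymbol P=\nabla\times\boldsymbol H,\qquad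 \partial_t\boldsymbol H=-\nabla\times\boldsymbol E,\qquad \boldsymbol P(t)=\Delta\epsilon\int_0^t e^{\beta}_{\alpha,\alpha\beta}(t-s;-1)\,\boldsymbol E(s)\,ds,$$ with $\boldsymbol n\times\boldsymbol E=0$ on $\partial\Omega$, $\boldsymbol E(0)=\boldsymbol E_0\in\boldsymbol L^2(\Omega)$, $\boldsymbol H(0)=\boldsymbol H_0\in\boldsymbol L^2(\Omega)$, $\boldsymbol P(0)=0$. A solution is a triple $\boldsymbol E,\boldsymbol H,\boldsymbol P:[0,T]\to\boldsymbol L^2(\Omega)$ of functions integrable in time, with these initial values, such that the integral defining $\boldsymbol P(t)$ exists and the formula for $\boldsymbol P(t)$ holds for every $t\in(0,T]$, and such that for all $t\in[0,T]$ $$\epsilon_\infty(\boldsymbol E(t),\phi)+(\boldsymbol P(t),\phi)=\epsilon_\infty(\boldsymbol E_0,\phi)+\int_0^t(\boldsymbol H(s),\nabla\times\phi)\,ds\quad\text{for all }\phi\in H_0(\mathrm{curl};\Omega),$$ $$(\boldsymbol H(t),\psi)=(\boldsymbol H_0,\psi)-\int_0^t(\boldsymbol E(s),\nabla\times\psi)\,ds\quad\text{for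 all }\psi\in H(\mathrm{curl};\Omega).$$ Then every solution satisfies $\boldsymbol E,\boldsymbol H,\boldsymbol P\in L^\infty(0,T;\boldsymbol L^2(\Omega))$, $$\epsilon_\infty\|\boldsymbol E(t)\|^2+\|\boldsymbol H(t)\|^2\le \epsilon_\infty\|\boldsymbol E_0\|^2+\|\boldsymbol H_0\|^2\qquad\text{for all }t\in(0,T),$$ and $$\|\boldsymbol P\|_{L^\infty(0,T;\boldsymbol L^2(\Omega))}\le\Delta\epsilon\,B\,\|\boldsymbol E\|_{L^\infty(0,T;\boldsymbol L^2(\Omega))},\qquad B=T^{\alpha\beta}\sum_{k=0}^{\infty}\frac{|(\beta)_k|}{\alpha(k+\beta)\,|\Gamma(\alpha k+\alpha\beta)|}\,\frac{T^{\alpha k}}{k!},$$ where the series defining $B$ converges. -/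

import Mathlib

open MeasureTheory Set
open scoped ENNReal ContDiff

noncomputable section

namespace HNMaxwell

/-- Three-dimensional Euclidean space. -/
abbrev E3 : Type := EuclideanSpace ℝ (Fin 3)

/-- The real Hilbert space `L²(Ω; ℝ³)` of square-integrable vector fields. -/
abbrev VecL2 (Ω : Set E3) : Type := Lp E3 2 (volume.restrict Ω)

/-- The partial derivative `∂ᵢ φⱼ` at `x`. -/
def pderiv (φ : E3 → E3) (i j : Fin 3) (x : E3) : ℝ :=
  (fderiv ℝ φ x (EuclideanSpace.single i 1)) j

/-- The classical curl of a differentiable vector field on `ℝ³`. -/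
def curl (φ : E3 → E3) (x : E3) : E3 :=
  !₂[pderiv φ 1 2 x - pderiv φ 2 1 x,
     pderiv φ 2 0 x - pderiv φ 0 2 x,
     pderiv φ 0 1 x - pderiv φ 1 0 x]

/-- `φ ∈ C_c^∞(Ω; ℝ³)`. -/
def IsTestField (Ω : Set E3) (φ : E3 → E3) : Prop :=
  ContDiff ℝ ∞ φ ∧ HasCompactSupport φ ∧ tsupport φ ⊆ Ω

/-- `v ∈ H(curl; Ω)` with `∇ × v = w`, in the sense of distributions. -/
def IsHCurl (Ω : Set E3) (v w : VecL2 Ω) : Prop :=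
  ∀ φ : E3 → E3, IsTestField Ω φ →
    ∫ x in Ω, inner ℝ (v x) (curl φ x) = ∫ x in Ω, inner ℝ (w x) (φ x)

/-- The pairs `(φ, ∇ × φ)` with `φ ∈ C_c^∞(Ω; ℝ³)`, as elements of `L² × L²`. -/
def testGraph (Ω : Set E3) : Set (VecL2 Ω × VecL2 Ω) :=
  {p | ∃ φ : E3 → E3, IsTestField Ω φ ∧
    p.1 =ᵐ[volume.restrict Ω] φ ∧ p.2 =ᵐ[volume.restrict Ω] curl φ}

/-- `v ∈ H₀(curl; Ω)` with `∇ × v = w`: the space `H₀(curl; Ω)` (vanishing tangential trace) is the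
closure of the test fields in the graph norm of the curl. -/
def IsH0Curl (Ω : Set E3) (v w : VecL2 Ω) : Prop :=
  (v, w) ∈ closure (testGraph Ω)

/-- The three-parameter Mittag-Leffler (Prabhakar) function
`E_{ρ,μ}^γ(z) = ∑ₖ (γ)ₖ / Γ(ρ k + μ) · zᵏ / k!`. -/
def prabhakar (ρ μ γ z : ℝ) : ℝ :=
  ∑' k : ℕ, (ascPochhammer ℝ k).eval γ / Real.Gamma (ρ * k + μ) * (z ^ k / (k.factorial : ℝ))

/-- The Prabhakar kernel `e_{ρ,μ}^γ(t; σ) = t^{μ-1} E_{ρ,μ}^γ(σ t^ρ)`. -/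
def prabhakarKernel (ρ μ γ σ t : ℝ) : ℝ :=
  t ^ (μ - 1) * prabhakar ρ μ γ (σ * t ^ ρ)

/-- The triple `(E, H, P)` is a weak solution on `[0, T]` of the rescaled Havriliak-Negami Maxwell
system

`ε_∞ ∂ₜE + ∂ₜP = ∇ × H`, `∂ₜH = -∇ × E`, `P(t) = Δε ∫₀ᵗ e_{α,αβ}^β(t - s; -1) E(s) ds`,
`n × E = 0` on `∂Ω`, `E(0) = E₀`, `H(0) = H₀`, `P(0) = 0`.

The two evolution equations are tested with `H₀(curl; Ω)` and `H(curl; Ω)` respectively and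
integrated in time. Since the second one is tested with all of `H(curl; Ω)`, it contains the
perfect-conductor condition `n × E = 0`. The fields are only asked to be integrable in time. -/
structure IsWeakSolution (Ω : Set E3) (T α β εinf Δε : ℝ) (E₀ H₀ : VecL2 Ω)
    (E H P : ℝ → VecL2 Ω) : Prop where
  integrable_E : IntegrableOn E (Icc 0 T)
  integrable_H : IntegrableOn H (Icc 0 T)
  integrable_P : IntegrableOn P (Icc 0 T)
  initial_E : E 0 = E₀
  initial_H : H 0 = H₀
  initial_P : P 0 = 0
  ampere : ∀ v w : VecL2 Ω, IsH0Curl Ω v w → ∀ t ∈ Icc 0 T,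
    εinf * inner ℝ (E t) v + inner ℝ (P t) v
      = εinf * inner ℝ E₀ v + ∫ s in (0 : ℝ)..t, inner ℝ (H s) w
  faraday : ∀ v w : VecL2 Ω, IsHCurl Ω v w → ∀ t ∈ Icc 0 T,
    inner ℝ (H t) v = inner ℝ H₀ v - ∫ s in (0 : ℝ)..t, inner ℝ (E s) w
  integrable_memory : ∀ t ∈ Ioc 0 T,
    IntervalIntegrable (fun s => prabhakarKernel α (α * β) β (-1) (t - s) • E s) volume 0 t
  polarisation : ∀ t ∈ Ioc 0 T,
    P t = Δε • ∫ s in (0 : ℝ)..t, prabhakarKernel α (α * β) β (-1) (t - s) • E s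

/-- The `k`-th term of the series in the constant `B`. -/
def boundTerm (α β T : ℝ) (k : ℕ) : ℝ :=
  |(ascPochhammer ℝ k).eval β| / (α * (k + β) * |Real.Gamma (α * k + α * β)|)
    * (T ^ (α * k) / (k.factorial : ℝ))

/-- The constant `B = T^{αβ} ∑ₖ |(β)ₖ| / (α (k + β) |Γ(α k + α β)|) · T^{α k} / k!`. -/
def boundConst (α β T : ℝ) : ℝ :=
  T ^ (α * β) * ∑' k : ℕ, boundTerm α β T k

end HNMaxwell

end

/-!
The proof is an energy argument in time, carried out on increments because the fields are only
integrable in time.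

*The kernel.* The memory kernel `k = e^β_{α,αβ}(·; -1)` has Laplace transform `(1 + s^α)^(-β)`. What
is needed is that `k` is positive and nonincreasing. Write `e(t) = E_α(-t^α)` for the Mittag-Leffler
function. Differentiating Laplace transforms suggests the convolution identities
`t e = (1 - α) (1 * e) + α (e * e)` and `t k = αβ (e * k)`, and they are checked on the power series
(`mul_mittagLeffler`, `mul_hnKernel`, from the convolution rule `fracSeries_conv`). Neither function
can therefore have a first zero (`mittagLeffler_pos`, `hnKernel_pos`). Monotonicity follows from
`-t k' = (1 - αβ) k + αβ k₂` (`hasDerivAt_hnKernel`), where `k₂`, with Laplace transform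
`(1 + s^α)^(-β-1)`, is positive for the same reason. Termwise integration bounds `∫₀ᵀ k` by the
constant `B`.

*The memory term.* For a nonnegative nonincreasing `k` and a causal `W` with primitive `U`, the
integral of `(k * W, U)` is nonnegative (`integral_memory_inner_nonneg`): by the layer-cake formula
this reduces to `k = 1_(0,a)`, where `k * W = U - U(· - a)`.

*The curl.* By Faraday's law, tested with all of `H(curl)`, the primitive of `E` lies in `H₀(curl)`,
as the graph of the closed curl is its own double orthogonal complement. It may hence be inserted
into Ampère's law, and the curl disappears: for all `s, t ∈ [0, T]`,
`(ε_∞ (E(t) - E₀) + P(t), ∫₀ˢ E) + (∫₀ᵗ H, H(s) - H₀) = 0` (`IsWeakSolution.two_time_identity`).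

*Energy.* Extend the fields by zero to negative times, take increments over `δ` in both times of
this identity and then put `s = t`. The result is an energy balance for the increments `U`, `V` over
`[t - δ, t]` of the primitives of `E` and `H`. Its memory term has a sign, and the initial data act
only on `(0, δ]`. A nonlinear Grönwall inequality gives
`ε_∞ ‖U‖² + ‖V‖² ≤ δ² (ε_∞ ‖E₀‖² + ‖H₀‖²)` with the sharp constant (`energy_increment_le`). Dividing
by `δ²`, Lebesgue differentiation yields the energy inequality for almost every `t`. Then `E` is
essentially bounded, `P` is continuous from the right, and weak continuity against the dense test
fields extends the inequality to every `t` (`energy_le_of_ae`). The bound for `P` is Young's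
inequality.
-/

noncomputable section

namespace HNMaxwell

open Filter Topology

/-! ### Fractional power series and their convolution -/

/-- The Riemann–Liouville kernel `t^(μ-1) / Γ(μ)`; these form a convolution semigroup in `μ`. -/
def rlKernel (μ t : ℝ) : ℝ := t ^ (μ - 1) / Real.Gamma μ

/-- The fractional power series `∑ₙ aₙ t^(αn+μ-1) / Γ(αn+μ)`. -/
def fracSeries (a : ℕ → ℝ) (α μ t : ℝ) : ℝ := ∑' n : ℕ, a n * rlKernel (α * n + μ) t

lemma rlKernel_nonneg {μ t : ℝ} (hμ : 0 < μ) (ht : 0 ≤ t) : 0 ≤ rlKernel μ t :=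
  div_nonneg (Real.rpow_nonneg ht _) (Real.Gamma_pos_of_pos hμ).le

lemma mul_rlKernel {μ t : ℝ} (hμ : 0 < μ) (ht : 0 < t) :
    t * rlKernel μ t = μ * rlKernel (μ + 1) t := by
  have h1 := (Real.Gamma_pos_of_pos hμ).ne'
  unfold rlKernel
  rw [Real.Gamma_add_one hμ.ne', Real.rpow_sub_one ht.ne', add_sub_cancel_right]
  field_simp

/-- A lower bound for the Gamma function, from the part of Euler's integral over `[R, R + 1]`. -/
lemma rpow_mul_exp_le_Gamma {R x : ℝ} (hR : 0 < R) (hx : 1 ≤ x) :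
    R ^ (x - 1) * Real.exp (-(R + 1)) ≤ Real.Gamma x := by
  rw [Real.Gamma_eq_integral (by linarith)]
  have hint := Real.GammaIntegral_convergent (s := x) (by linarith)
  have hsub : Ioc R (R + 1) ⊆ Ioi 0 := fun y hy => hR.trans hy.1
  calc R ^ (x - 1) * Real.exp (-(R + 1))
      = ∫ _ in Ioc R (R + 1), R ^ (x - 1) * Real.exp (-(R + 1)) := by simp
    _ ≤ ∫ y in Ioc R (R + 1), Real.exp (-y) * y ^ (x - 1) := by
        refine setIntegral_mono_on (integrableOn_const (by simp)) (hint.mono_set hsub)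
          measurableSet_Ioc ?_
        intro y hy
        rw [mul_comm]
        have h1 := hy.1.le
        have h2 := hy.2
        gcongr
    _ ≤ ∫ y in Ioi 0, Real.exp (-y) * y ^ (x - 1) := by
        refine setIntegral_mono_set hint ?_ hsub.eventuallyLE
        filter_upwards [ae_restrict_mem measurableSet_Ioi] with y hy
        have : (0 : ℝ) < y := hy
        positivity

/-- Polynomially weighted fractional power series converge: all coefficient sequences below grow at
most linearly, and Cauchy products cost two further powers of `n`. -/
lemma summable_rlKernel {α μ t : ℝ} (hα : 0 < α) (hμ : 0 < μ) (ht : 0 < t) (p : ℕ) :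
    Summable fun n : ℕ => ((n : ℝ) + 1) ^ p * rlKernel (α * n + μ) t := by
  -- with `R = 2^(1/α) t` the terms are eventually dominated by a multiple of `(n+1)^p 2^(-n)`
  set R : ℝ := 2 ^ (1 / α) * t with hR
  have hRpos : 0 < R := by positivity
  have hsum : Summable fun n : ℕ => ((n : ℝ) + 1) ^ p * (1 / 2 : ℝ) ^ n := by
    have h := summable_pow_mul_geometric_of_norm_lt_one (R := ℝ) p (r := 1 / 2)
      (by norm_num)
    have h2 := (summable_nat_add_iff 1).2 h
    refine (h2.mul_left 2).congr fun n => ?_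
    push_cast
    ring
  have hev : ∀ᶠ n : ℕ in atTop, 1 ≤ α * n + μ := by
    filter_upwards [(tendsto_natCast_atTop_atTop (R := ℝ)).eventually_ge_atTop (1 / α)] with n hn
    rw [div_le_iff₀ hα] at hn
    nlinarith
  refine Summable.of_norm_bounded_eventually_nat
    (g := fun n => (Real.exp (R + 1) * (t / R) ^ (μ - 1)) * (((n : ℝ) + 1) ^ p * (1 / 2 : ℝ) ^ n))
    (hsum.mul_left _) ?_
  filter_upwards [hev] with n hn
  have hG := rpow_mul_exp_le_Gamma hRpos hn
  have hpos : 0 < R ^ (α * n + μ - 1) * Real.exp (-(R + 1)) := by positivity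
  have hx : 0 < α * n + μ := by linarith
  rw [Real.norm_of_nonneg (mul_nonneg (by positivity) (rlKernel_nonneg hx ht.le))]
  have htR : t / R = (2 : ℝ) ^ (-(1 / α)) := by
    rw [hR, Real.rpow_neg (by norm_num)]; field_simp
  have hgeo : (t / R) ^ (α * n) = (1 / 2 : ℝ) ^ n := by
    rw [htR, ← Real.rpow_mul (by norm_num), ← Real.rpow_natCast, one_div (2 : ℝ),
      Real.inv_rpow (by norm_num), ← Real.rpow_neg (by norm_num)]
    congr 1
    field_simp
  calc ((n : ℝ) + 1) ^ p * rlKernel (α * n + μ) t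
      ≤ ((n : ℝ) + 1) ^ p *
        (t ^ (α * n + μ - 1) / (R ^ (α * n + μ - 1) * Real.exp (-(R + 1)))) := by
        unfold rlKernel
        gcongr
    _ = _ := by
        rw [Real.exp_neg, div_mul_eq_div_div, ← Real.div_rpow ht.le hRpos.le, add_sub_assoc,
          Real.rpow_add (by positivity), hgeo]
        field_simp

lemma rlKernel_conv {a b t : ℝ} (ha : 0 < a) (hb : 0 < b) (ht : 0 < t) :
    IntervalIntegrable (fun s => rlKernel a (t - s) * rlKernel b s) volume 0 t ∧
    ∫ s in (0 : ℝ)..t, rlKernel a (t - s) * rlKernel b s = rlKernel (a + b) t := by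
  have hga := (Real.Gamma_pos_of_pos ha).ne'
  have hgb := (Real.Gamma_pos_of_pos hb).ne'
  have hgab := (Real.Gamma_pos_of_pos (add_pos ha hb)).ne'
  have hval : ∫ s in (0 : ℝ)..t, rlKernel a (t - s) * rlKernel b s = rlKernel (a + b) t := by
    have h := Complex.betaIntegral_scaled (b : ℂ) (a : ℂ) ht
    have hB : Complex.betaIntegral b a =
        ((Real.Gamma b * Real.Gamma a / Real.Gamma (a + b) : ℝ) : ℂ) := by
      rw [Complex.betaIntegral_eq_Gamma_mul_div _ _ (by simpa) (by simpa)]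
      push_cast
      rw [← Complex.Gamma_ofReal, ← Complex.Gamma_ofReal, ← Complex.Gamma_ofReal, add_comm a b]
      push_cast
      rfl
    have hre : ∫ s in (0 : ℝ)..t, s ^ (b - 1) * (t - s) ^ (a - 1) =
        t ^ (b + a - 1) * (Real.Gamma b * Real.Gamma a / Real.Gamma (a + b)) := by
      rw [hB] at h
      apply Complex.ofReal_injective
      rw [← intervalIntegral.integral_ofReal, Complex.ofReal_mul,
        Complex.ofReal_cpow ht.le]
      push_cast at h ⊢
      rw [← h]
      refine intervalIntegral.integral_congr fun s hs => ?_
      rw [uIcc_of_le ht.le] at hs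
      rw [Complex.ofReal_cpow hs.1, Complex.ofReal_cpow (by linarith [hs.2])]
      push_cast
      rfl
    have : ∀ s, rlKernel a (t - s) * rlKernel b s =
        (s ^ (b - 1) * (t - s) ^ (a - 1)) * (1 / (Real.Gamma a * Real.Gamma b)) := by
      intro s
      unfold rlKernel
      field_simp
    simp_rw [this]
    rw [intervalIntegral.integral_mul_const, hre, rlKernel, add_comm b a]
    field_simp
  refine ⟨?_, hval⟩
  by_contra hcon
  rw [intervalIntegral.integral_undef hcon] at hval
  have : 0 < rlKernel (a + b) t :=
    div_pos (Real.rpow_pos_of_pos ht _) (Real.Gamma_pos_of_pos (add_pos ha hb))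
  linarith

lemma summable_fracSeries {a : ℕ → ℝ} (ha : ∀ n, |a n| ≤ n + 1) {α μ t : ℝ} (hα : 0 < α)
    (hμ : 0 < μ) (ht : 0 < t) : Summable fun n : ℕ => ‖a n * rlKernel (α * n + μ) t‖ := by
  refine Summable.of_nonneg_of_le (fun _ => norm_nonneg _) (fun n => ?_)
    (summable_rlKernel hα hμ ht 1)
  have h := rlKernel_nonneg (μ := α * n + μ) (by positivity) ht.le
  rw [norm_mul, Real.norm_eq_abs, Real.norm_of_nonneg h, pow_one]
  exact mul_le_mul_of_nonneg_right (ha n) h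

lemma summable_antidiagonal_mul_rlKernel {a b : ℕ → ℝ} (ha : ∀ n, |a n| ≤ n + 1)
    (hb : ∀ n, |b n| ≤ n + 1) {α μ t : ℝ} (hα : 0 < α) (hμ : 0 < μ) (ht : 0 < t) :
    Summable fun x : (Σ n : ℕ, Finset.HasAntidiagonal.antidiagonal n) =>
      |a x.2.1.1 * b x.2.1.2| * rlKernel (α * x.1 + μ) t := by
  have hpos : ∀ n : ℕ, 0 ≤ rlKernel (α * n + μ) t :=
    fun n => rlKernel_nonneg (by positivity) ht.le
  rw [summable_sigma_of_nonneg fun x => mul_nonneg (abs_nonneg _) (hpos _)]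
  refine ⟨fun n => (hasSum_fintype _).summable, ?_⟩
  refine Summable.of_nonneg_of_le (fun n => tsum_nonneg fun _ =>
    mul_nonneg (abs_nonneg _) (hpos _)) (fun n => ?_) (summable_rlKernel hα hμ ht 3)
  rw [tsum_fintype]
  dsimp only
  rw [← Finset.sum_mul]
  refine mul_le_mul_of_nonneg_right ?_ (hpos n)
  have : ∀ x ∈ (Finset.univ : Finset (Finset.HasAntidiagonal.antidiagonal n)),
      |a x.1.1 * b x.1.2| ≤ ((n : ℝ) + 1) ^ 2 := by
    intro x _
    have hx := Finset.HasAntidiagonal.mem_antidiagonal.1 x.2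
    have h1 : (x.1.1 : ℝ) ≤ n := by exact_mod_cast (by omega)
    have h2 : (x.1.2 : ℝ) ≤ n := by exact_mod_cast (by omega)
    rw [abs_mul, sq]
    exact mul_le_mul ((ha _).trans (by linarith)) ((hb _).trans (by linarith)) (abs_nonneg _)
      (by positivity)
  refine (Finset.sum_le_card_nsmul _ _ _ this).trans (le_of_eq ?_)
  simp
  ring

/-- Fractional power series convolve by taking the Cauchy product of the coefficients. -/
lemma fracSeries_conv {a b : ℕ → ℝ} (ha : ∀ n, |a n| ≤ n + 1) (hb : ∀ n, |b n| ≤ n + 1)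
    {α μ ν t : ℝ} (hα : 0 < α) (hμ : 0 < μ) (hν : 0 < ν) (ht : 0 < t) :
    ∫ s in (0 : ℝ)..t, fracSeries a α μ (t - s) * fracSeries b α ν s =
      fracSeries (fun n => ∑ p ∈ Finset.HasAntidiagonal.antidiagonal n, a p.1 * b p.2) α
        (μ + ν) t := by
  set F : ℕ × ℕ → ℝ → ℝ := fun p s =>
    (a p.1 * rlKernel (α * p.1 + μ) (t - s)) * (b p.2 * rlKernel (α * p.2 + ν) s) with hF
  have hFeq : ∀ p s, F p s = (a p.1 * b p.2) *
      (rlKernel (α * p.1 + μ) (t - s) * rlKernel (α * p.2 + ν) s) := by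
    intro p s; simp only [hF]; ring
  have hconv := fun p : ℕ × ℕ => rlKernel_conv (a := α * p.1 + μ) (b := α * p.2 + ν)
    (by positivity) (by positivity) ht
  have hidx : ∀ p : ℕ × ℕ, (α * p.1 + μ) + (α * p.2 + ν) = α * ((p.1 + p.2 : ℕ) : ℝ) + (μ + ν) := by
    intro p; push_cast; ring
  have hint : ∀ p, Integrable (F p) (volume.restrict (Ioc 0 t)) := by
    intro p
    have := ((hconv p).1.const_mul (a p.1 * b p.2)).1
    simpa only [IntegrableOn, ← hFeq] using this
  have hval : ∀ p, ∫ s in Ioc 0 t, F p s =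
      (a p.1 * b p.2) * rlKernel (α * ((p.1 + p.2 : ℕ) : ℝ) + (μ + ν)) t := by
    intro p
    rw [← intervalIntegral.integral_of_le ht.le]
    simp_rw [hFeq]
    rw [intervalIntegral.integral_const_mul, (hconv p).2, hidx]
  have hnorm : ∀ p, ∫ s in Ioc 0 t, ‖F p s‖ =
      |a p.1 * b p.2| * rlKernel (α * ((p.1 + p.2 : ℕ) : ℝ) + (μ + ν)) t := by
    intro p
    rw [← hidx, ← (hconv p).2, intervalIntegral.integral_of_le ht.le, ← integral_const_mul]
    refine setIntegral_congr_fun measurableSet_Ioc fun s hs => ?_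
    rw [hFeq, norm_mul, Real.norm_eq_abs, Real.norm_of_nonneg]
    exact mul_nonneg (rlKernel_nonneg (by positivity) (by linarith [hs.2]))
      (rlKernel_nonneg (by positivity) hs.1.le)
  have hd := summable_antidiagonal_mul_rlKernel ha hb hα (add_pos hμ hν) ht
  have hsig : ∀ x : (Σ n : ℕ, Finset.HasAntidiagonal.antidiagonal n),
      (x.2.1.1 + x.2.1.2 : ℕ) = x.1 := fun x => Finset.HasAntidiagonal.mem_antidiagonal.1 x.2.2
  have hsumnorm : Summable fun p => ∫ s in Ioc 0 t, ‖F p s‖ := by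
    rw [← (Finset.HasAntidiagonal.sigmaAntidiagonalEquivProd (A := ℕ)).summable_iff]
    refine hd.congr fun x => ?_
    simp only [Function.comp, hnorm, Finset.HasAntidiagonal.sigmaAntidiagonalEquivProd_apply, hsig]
  have hsum : Summable fun x : (Σ n : ℕ, Finset.HasAntidiagonal.antidiagonal n) =>
      (a x.2.1.1 * b x.2.1.2) * rlKernel (α * x.1 + (μ + ν)) t := by
    refine Summable.of_norm (hd.congr fun x => ?_)
    rw [norm_mul, Real.norm_eq_abs, Real.norm_of_nonneg
      (rlKernel_nonneg (by positivity) ht.le)]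
  have key := integral_tsum_of_summable_integral_norm hint hsumnorm
  rw [intervalIntegral.integral_of_le ht.le, integral_Ioc_eq_integral_Ioo]
  rw [integral_Ioc_eq_integral_Ioo] at key
  have hL : ∫ s in Ioo 0 t, fracSeries a α μ (t - s) * fracSeries b α ν s =
      ∫ s in Ioo 0 t, ∑' p, F p s := by
    refine setIntegral_congr_fun measurableSet_Ioo fun s hs => ?_
    simp only [hF, fracSeries]
    exact tsum_mul_tsum_of_summable_norm
      (summable_fracSeries ha hα hμ (by linarith [hs.2]))
      (summable_fracSeries hb hα hν hs.1)
  rw [hL, ← key, ← (Finset.HasAntidiagonal.sigmaAntidiagonalEquivProd (A := ℕ)).tsum_eq]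
  have : ∀ x : (Σ n : ℕ, Finset.HasAntidiagonal.antidiagonal n),
      ∫ s in Ioc 0 t, F (Finset.HasAntidiagonal.sigmaAntidiagonalEquivProd x) s =
      (a x.2.1.1 * b x.2.1.2) * rlKernel (α * x.1 + (μ + ν)) t := by
    intro x
    rw [hval]
    simp only [Finset.HasAntidiagonal.sigmaAntidiagonalEquivProd_apply, hsig]
  simp_rw [this]
  rw [hsum.tsum_sigma' (fun n => (hasSum_fintype _).summable), fracSeries]
  refine tsum_congr fun n => ?_
  rw [tsum_fintype]
  dsimp only
  rw [← Finset.sum_mul]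
  congr 1
  exact Finset.sum_coe_sort (Finset.HasAntidiagonal.antidiagonal n) (fun p => a p.1 * b p.2)

/-! ### Positivity and monotonicity of the memory kernel -/

/-- The factor `∑ₙ aₙ t^(αn) / Γ(αn+μ)` of a fractional power series, which is continuous up to
`t = 0`; the other factor is `t^(μ-1)`. -/
def regSeries (a : ℕ → ℝ) (α μ t : ℝ) : ℝ := ∑' n : ℕ, a n * (t ^ (α * n) / Real.Gamma (α * n + μ))

lemma rpow_mul_regSeries (a : ℕ → ℝ) (α μ : ℝ) {t : ℝ} (ht : 0 < t) :
    fracSeries a α μ t = t ^ (μ - 1) * regSeries a α μ t := by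
  unfold fracSeries regSeries rlKernel
  rw [← tsum_mul_left]
  refine tsum_congr fun n => ?_
  rw [add_sub_assoc, Real.rpow_add ht]
  ring

lemma regSeries_zero (a : ℕ → ℝ) {α : ℝ} (hα : 0 < α) (μ : ℝ) :
    regSeries a α μ 0 = a 0 / Real.Gamma μ := by
  unfold regSeries
  rw [tsum_eq_single 0]
  · simp [div_eq_mul_inv]
  · intro n hn
    rw [Real.zero_rpow (by positivity)]
    simp

lemma continuousOn_regSeries {a : ℕ → ℝ} (ha : ∀ n, |a n| ≤ n + 1) {α μ : ℝ} (hα : 0 < α)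
    (hμ : 0 < μ) : ContinuousOn (regSeries a α μ) (Ici 0) := by
  have hR : ∀ R : ℝ, 0 < R → ContinuousOn (regSeries a α μ) (Icc 0 R) := by
    intro R hR
    have hs := ((summable_rlKernel hα hμ hR 1).mul_left (R ^ (1 - μ)))
    refine continuousOn_tsum (fun n => ?_) hs ?_
    · exact ((Real.continuous_rpow_const (by positivity)).div_const _).const_mul _ |>.continuousOn
    · intro n t ht
      have hG : 0 < Real.Gamma (α * n + μ) := Real.Gamma_pos_of_pos (by positivity)
      have h1 : R ^ (1 - μ) * (((n : ℝ) + 1) ^ 1 * rlKernel (α * n + μ) R) =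
          (n + 1) * (R ^ (α * n) / Real.Gamma (α * n + μ)) := by
        unfold rlKernel
        have : R ^ (α * n) = R ^ (1 - μ) * R ^ (α * n + μ - 1) := by
          rw [← Real.rpow_add hR]; ring_nf
        rw [this]; ring
      rw [h1, norm_mul, Real.norm_eq_abs, Real.norm_of_nonneg
        (div_nonneg (Real.rpow_nonneg ht.1 _) hG.le)]
      have := ht.1
      have := ht.2
      have := ha n
      gcongr
  intro t ht
  refine ((hR (t + 1) (by linarith [mem_Ici.1 ht])) t ⟨ht, by linarith⟩).mono_of_mem_nhdsWithin ?_
  rw [← Ici_inter_Iic]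
  exact inter_mem self_mem_nhdsWithin (mem_nhdsWithin_of_mem_nhds (Iic_mem_nhds (by linarith)))

lemma intervalIntegrable_mul_fracSeries {a : ℕ → ℝ} (ha : ∀ n, |a n| ≤ n + 1) {α μ : ℝ}
    (hα : 0 < α) (hμ : 0 < μ) {t : ℝ} (ht : 0 ≤ t) {f : ℝ → ℝ} (hf : ContinuousOn f (Icc 0 t)) :
    IntervalIntegrable (fun s => f s * fracSeries a α μ s) volume 0 t := by
  have h1 : IntervalIntegrable (fun s : ℝ => s ^ (μ - 1) * (f s * regSeries a α μ s))
      volume 0 t := by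
    refine (intervalIntegral.intervalIntegrable_rpow' (by linarith)).mul_continuousOn ?_
    rw [uIcc_of_le ht]
    exact hf.mul ((continuousOn_regSeries ha hα hμ).mono fun s hs => hs.1)
  refine h1.congr fun s hs => ?_
  rw [uIoc_of_le ht] at hs
  rw [rpow_mul_regSeries _ _ _ hs.1]
  ring

lemma intervalIntegrable_fracSeries {a : ℕ → ℝ} (ha : ∀ n, |a n| ≤ n + 1) {α μ : ℝ}
    (hα : 0 < α) (hμ : 0 < μ) {t : ℝ} (ht : 0 ≤ t) :
    IntervalIntegrable (fracSeries a α μ) volume 0 t := by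
  simpa using intervalIntegrable_mul_fracSeries ha hα hμ ht (f := fun _ => 1) continuousOn_const

/-- A continuous function that starts positive stays positive if it is positive at every time up to
which it has been positive. -/
lemma pos_of_pos_before {m : ℝ → ℝ} (hm : ContinuousOn m (Ici 0)) (h0 : 0 < m 0)
    (hstep : ∀ t, 0 < t → (∀ s ∈ Ico 0 t, 0 < m s) → 0 < m t) {t : ℝ} (ht : 0 ≤ t) : 0 < m t := by
  by_contra! hcon
  set S := Icc 0 t ∩ m ⁻¹' Iic 0
  have hcl : IsClosed S :=
    (hm.mono fun s hs => hs.1).preimage_isClosed_of_isClosed isClosed_Icc isClosed_Iic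
  have hcomp : IsCompact S := isCompact_Icc.of_isClosed_subset hcl inter_subset_left
  obtain ⟨r, hr, hmin⟩ := hcomp.exists_isLeast ⟨t, ⟨ht, le_rfl⟩, hcon⟩
  have hr0 : 0 < r := lt_of_le_of_ne hr.1.1 fun h => by
    have : m r ≤ 0 := hr.2
    rw [← h] at this
    linarith
  have : m r ≤ 0 := hr.2
  refine absurd (hstep r hr0 fun s hs => ?_) this.not_gt
  by_contra! hs0
  have := hmin ⟨⟨hs.1, hs.2.le.trans hr.1.2⟩, hs0⟩
  linarith [hs.2]

lemma mul_fracSeries (a : ℕ → ℝ) {α μ t : ℝ} (hα : 0 < α) (hμ : 0 < μ) (ht : 0 < t) :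
    t * fracSeries a α μ t = ∑' n : ℕ, a n * (α * n + μ) * rlKernel (α * n + (μ + 1)) t := by
  unfold fracSeries
  rw [← tsum_mul_left]
  refine tsum_congr fun n => ?_
  rw [mul_left_comm, mul_rlKernel (by positivity) ht, add_assoc]
  ring

/-- Termwise integration of a fractional power series. -/
lemma integral_fracSeries {a : ℕ → ℝ} (ha : ∀ n, |a n| ≤ n + 1) {α μ t : ℝ} (hα : 0 < α)
    (hμ : 0 < μ) (ht : 0 < t) :
    ∫ s in (0 : ℝ)..t, fracSeries a α μ s = fracSeries a α (μ + 1) t := by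
  -- the constant function `1` is the fractional power series with coefficients `1, 0, 0, …`
  have hδ : ∀ n : ℕ, |(if n = 0 then (1 : ℝ) else 0)| ≤ n + 1 := by
    intro n; split_ifs with h <;> simp; positivity
  have h := fracSeries_conv hδ ha hα one_pos hμ ht
  have hone : ∀ s, fracSeries (fun n => if n = 0 then (1 : ℝ) else 0) α 1 s = 1 := by
    intro s
    unfold fracSeries
    rw [tsum_eq_single 0 (fun n hn => by simp [hn])]
    simp [rlKernel]
  simp only [hone, one_mul] at h
  rw [h, add_comm]
  congr 1
  funext n
  rw [Finset.Nat.sum_antidiagonal_eq_sum_range_succ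
    (fun i j => (if i = 0 then (1 : ℝ) else 0) * a j), Finset.sum_eq_single 0]
  · simp
  · intro i _ hi; simp [hi]
  · simp

/-- The Mittag-Leffler function `E_α(-t^α)`, as a function of `t`, encoded as the fractional power
series with coefficients `(-1)ⁿ` and `μ = 1`. -/
def mittagLeffler (α t : ℝ) : ℝ := fracSeries (fun n => (-1) ^ n) α 1 t

lemma abs_neg_one_pow_le (n : ℕ) : |((-1 : ℝ)) ^ n| ≤ n + 1 := by simp

lemma mittagLeffler_eq_regSeries (α t : ℝ) :
    mittagLeffler α t = regSeries (fun n => (-1) ^ n) α 1 t := by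
  unfold mittagLeffler fracSeries regSeries rlKernel
  simp

lemma continuousOn_mittagLeffler {α : ℝ} (hα : 0 < α) : ContinuousOn (mittagLeffler α) (Ici 0) :=
  (continuousOn_regSeries abs_neg_one_pow_le hα one_pos).congr
    fun t _ => mittagLeffler_eq_regSeries α t

/-- Differentiating the Laplace transform `s^(α-1) / (1 + s^α)` of `e(t) = E_α(-t^α)` gives
`t e = (1 - α) (1 * e) + α (e * e)`. -/
lemma mul_mittagLeffler {α t : ℝ} (hα : 0 < α) (ht : 0 < t) :
    t * mittagLeffler α t = (1 - α) * (∫ s in (0 : ℝ)..t, mittagLeffler α s) +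
      α * ∫ s in (0 : ℝ)..t, mittagLeffler α (t - s) * mittagLeffler α s := by
  have h1 : ∫ s in (0 : ℝ)..t, mittagLeffler α s =
      fracSeries (fun n => (-1) ^ n) α (1 + 1) t :=
    integral_fracSeries abs_neg_one_pow_le hα one_pos ht
  have hc : (fun n : ℕ => ∑ p ∈ Finset.HasAntidiagonal.antidiagonal n,
      ((-1 : ℝ)) ^ p.1 * (-1) ^ p.2) = fun n : ℕ => (-1) ^ n * ((n : ℝ) + 1) := by
    funext n
    rw [Finset.sum_congr rfl (g := fun _ => ((-1 : ℝ)) ^ n)]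
    · simp [mul_comm]
    · intro p hp
      rw [← pow_add, Finset.HasAntidiagonal.mem_antidiagonal.1 hp]
  have h2 := fracSeries_conv abs_neg_one_pow_le abs_neg_one_pow_le hα one_pos one_pos ht
  rw [hc] at h2
  rw [h1]
  unfold mittagLeffler
  rw [h2, mul_fracSeries _ hα one_pos ht]
  unfold fracSeries
  have hs1 := (summable_fracSeries abs_neg_one_pow_le hα (μ := 1 + 1) (by norm_num) ht).of_norm
  have hs2 := (summable_fracSeries (a := fun n : ℕ => (-1) ^ n * ((n : ℝ) + 1))
    (fun n => by rw [abs_mul]; simp [abs_of_nonneg (by positivity : (0 : ℝ) ≤ n + 1)])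
    hα (μ := 1 + 1) (by norm_num) ht).of_norm
  rw [← tsum_mul_left, ← tsum_mul_left, ← (hs1.mul_left _).tsum_add (hs2.mul_left _)]
  refine tsum_congr fun n => ?_
  ring

/-- The Mittag-Leffler function `E_α(-t^α)` is positive for `0 < α ≤ 1`: at a first zero, the
identity `mul_mittagLeffler` would equate zero with a positive quantity. -/
lemma mittagLeffler_pos {α : ℝ} (hα : 0 < α) (hα' : α ≤ 1) {t : ℝ} (ht : 0 ≤ t) :
    0 < mittagLeffler α t := by
  refine pos_of_pos_before (continuousOn_mittagLeffler hα) ?_ ?_ ht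
  · rw [mittagLeffler_eq_regSeries, regSeries_zero _ hα]; simp
  · intro t ht hpos
    have hc : ContinuousOn (mittagLeffler α) (Icc 0 t) :=
      (continuousOn_mittagLeffler hα).mono fun s hs => hs.1
    have hc' : ContinuousOn (fun s => mittagLeffler α (t - s)) (Icc 0 t) :=
      hc.comp (by fun_prop) fun s hs => ⟨by linarith [hs.2], by linarith [hs.1]⟩
    have h1 : 0 ≤ ∫ s in (0 : ℝ)..t, mittagLeffler α s := by
      rw [intervalIntegral.integral_of_le ht.le, integral_Ioc_eq_integral_Ioo]
      exact setIntegral_nonneg measurableSet_Ioo fun s hs => (hpos s ⟨hs.1.le, hs.2⟩).le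
    have h2 : 0 < ∫ s in (0 : ℝ)..t, mittagLeffler α (t - s) * mittagLeffler α s := by
      refine intervalIntegral.intervalIntegral_pos_of_pos_on ?_ (fun s hs => ?_) ht
      · exact (hc'.mul hc).intervalIntegrable_of_Icc ht.le
      · exact mul_pos (hpos _ ⟨by linarith [hs.2], by linarith [hs.1]⟩) (hpos s ⟨hs.1.le, hs.2⟩)
    have h3 := mul_mittagLeffler hα ht
    have h4 : 0 < t * mittagLeffler α t := by
      rw [h3]
      have := mul_nonneg (sub_nonneg.2 hα') h1
      have := mul_pos hα h2
      linarith
    exact pos_of_mul_pos_right h4 ht.le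

/-- The coefficients `(γ)ₙ / n!` of the binomial series of `(1 - z)^(-γ)`. -/
def binomCoeff (γ : ℝ) (n : ℕ) : ℝ := (ascPochhammer ℝ n).eval γ / n.factorial

lemma binomCoeff_succ (γ : ℝ) (n : ℕ) :
    binomCoeff γ (n + 1) = binomCoeff γ n * (γ + n) / (n + 1) := by
  unfold binomCoeff
  rw [ascPochhammer_succ_eval, Nat.factorial_succ]
  push_cast
  field_simp

lemma binomCoeff_add_one (γ : ℝ) (n : ℕ) :
    binomCoeff (γ + 1) n * γ = binomCoeff γ n * (γ + n) := by
  induction n with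
  | zero => simp [binomCoeff]
  | succ n ih =>
    rw [binomCoeff_succ, binomCoeff_succ, div_mul_eq_mul_div, mul_right_comm, ih]
    push_cast
    field_simp
    ring

lemma sum_binomCoeff (γ : ℝ) (n : ℕ) :
    ∑ j ∈ Finset.range (n + 1), binomCoeff γ j = binomCoeff (γ + 1) n := by
  induction n with
  | zero => simp [binomCoeff]
  | succ n ih =>
    rw [Finset.sum_range_succ, ih, binomCoeff_succ, ← binomCoeff_add_one, binomCoeff_succ]
    field_simp
    ring

lemma binomCoeff_pos {γ : ℝ} (hγ : 0 < γ) (n : ℕ) : 0 < binomCoeff γ n :=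
  div_pos (ascPochhammer_pos n γ hγ) (by positivity)

lemma binomCoeff_le {γ : ℝ} (hγ : 0 < γ) (hγ' : γ ≤ 2) (n : ℕ) : binomCoeff γ n ≤ n + 1 := by
  induction n with
  | zero => simp [binomCoeff]
  | succ n ih =>
    rw [binomCoeff_succ, div_le_iff₀ (by positivity), mul_comm (binomCoeff γ n)]
    have := (binomCoeff_pos hγ n).le
    push_cast
    exact mul_le_mul (by linarith) ih this (by positivity)

/-- The coefficients `(-1)ⁿ (γ)ₙ / n!` of `(1 + z)^(-γ)`, hence of the kernel with Laplace
transform `(1 + s^α)^(-γ) = s^(-αγ) (1 + s^(-α))^(-γ)`. -/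
def signedCoeff (γ : ℝ) (n : ℕ) : ℝ := (-1) ^ n * binomCoeff γ n

/-- The kernel `t^(αγ-1) E^γ_{α,αγ}(-t^α)`, whose Laplace transform is `(1 + s^α)^(-γ)`. -/
def hnKernel (α γ t : ℝ) : ℝ := fracSeries (signedCoeff γ) α (α * γ) t

lemma prabhakarKernel_eq_hnKernel (α γ : ℝ) {t : ℝ} (ht : 0 < t) :
    prabhakarKernel α (α * γ) γ (-1) t = hnKernel α γ t := by
  rw [hnKernel, rpow_mul_regSeries _ _ _ ht, prabhakarKernel, prabhakar, regSeries]
  congr 1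
  refine tsum_congr fun n => ?_
  rw [signedCoeff, binomCoeff, mul_pow, ← Real.rpow_mul_natCast ht.le]
  ring

lemma abs_signedCoeff {γ : ℝ} (hγ : 0 < γ) (n : ℕ) : |signedCoeff γ n| = binomCoeff γ n := by
  rw [signedCoeff, abs_mul]; simp [abs_of_pos (binomCoeff_pos hγ n)]

/-- The range `γ ≤ 2` covers the exponents `β` and `β + 1` of the kernel and of its derivative. -/
lemma abs_signedCoeff_le {γ : ℝ} (hγ : 0 < γ) (hγ' : γ ≤ 2) (n : ℕ) :
    |signedCoeff γ n| ≤ n + 1 :=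
  (abs_signedCoeff hγ n).trans_le (binomCoeff_le hγ hγ' n)

/-- Differentiating the Laplace transform `(1 + s^α)^(-γ)` of `k` gives `t k = αγ (e * k)`, with the
Mittag-Leffler function `e(t) = E_α(-t^α)`. -/
lemma mul_hnKernel {α γ t : ℝ} (hα : 0 < α) (hγ : 0 < γ) (hγ' : γ ≤ 2) (ht : 0 < t) :
    t * hnKernel α γ t =
      α * γ * ∫ s in (0 : ℝ)..t, mittagLeffler α (t - s) * hnKernel α γ s := by
  have h := fracSeries_conv abs_neg_one_pow_le (abs_signedCoeff_le hγ hγ') hα one_pos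
    (mul_pos hα hγ) ht
  have hc : (fun n : ℕ => ∑ p ∈ Finset.HasAntidiagonal.antidiagonal n,
      ((-1 : ℝ)) ^ p.1 * signedCoeff γ p.2) = fun n : ℕ => (-1) ^ n * binomCoeff (γ + 1) n := by
    funext n
    rw [Finset.sum_congr rfl (g := fun p => (-1 : ℝ) ^ n * binomCoeff γ p.2),
      ← Finset.mul_sum, ← sum_binomCoeff,
      Finset.Nat.sum_antidiagonal_eq_sum_range_succ (fun _ j => binomCoeff γ j),
      ← Finset.sum_range_reflect]
    · congr 1
      refine Finset.sum_congr rfl fun j hj => ?_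
      have := Finset.mem_range.1 hj
      congr 1
      omega
    · intro p hp
      rw [signedCoeff, ← mul_assoc, ← pow_add, Finset.HasAntidiagonal.mem_antidiagonal.1 hp]
  rw [hc] at h
  unfold mittagLeffler hnKernel
  rw [h, mul_fracSeries _ hα (mul_pos hα hγ) ht, fracSeries, ← tsum_mul_left]
  refine tsum_congr fun n => ?_
  have := binomCoeff_add_one γ n
  rw [add_comm 1 (α * γ), signedCoeff]
  linear_combination (-(α * (-1) ^ n * rlKernel (α * n + (α * γ + 1)) t)) * this

/-- The kernel with Laplace transform `(1 + s^α)^(-γ)` is positive, by the first-zero argument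
applied to `mul_hnKernel`. -/
lemma hnKernel_pos {α γ : ℝ} (hα : 0 < α) (hα' : α ≤ 1) (hγ : 0 < γ) (hγ' : γ ≤ 2) {t : ℝ}
    (ht : 0 < t) : 0 < hnKernel α γ t := by
  have hb := abs_signedCoeff_le hγ hγ'
  have hμ : 0 < α * γ := mul_pos hα hγ
  have hiff : ∀ s, 0 < s → (0 < hnKernel α γ s ↔ 0 < regSeries (signedCoeff γ) α (α * γ) s) := by
    intro s hs
    rw [hnKernel, rpow_mul_regSeries _ _ _ hs]
    exact mul_pos_iff_of_pos_left (Real.rpow_pos_of_pos hs _)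
  rw [hiff t ht]
  refine pos_of_pos_before (continuousOn_regSeries hb hα hμ) ?_ ?_ ht.le
  · rw [regSeries_zero _ hα]
    exact div_pos (by simp [signedCoeff, binomCoeff]) (Real.Gamma_pos_of_pos hμ)
  · intro t ht hpos
    rw [← hiff t ht]
    have hc' : ContinuousOn (fun s => mittagLeffler α (t - s)) (Icc 0 t) :=
      (continuousOn_mittagLeffler hα).comp (by fun_prop) fun s hs => by
        simpa using hs.2
    have h2 : 0 < ∫ s in (0 : ℝ)..t, mittagLeffler α (t - s) * hnKernel α γ s := by
      refine intervalIntegral.intervalIntegral_pos_of_pos_on ?_ (fun s hs => ?_) ht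
      · exact intervalIntegrable_mul_fracSeries hb hα hμ ht.le hc'
      · exact mul_pos (mittagLeffler_pos hα hα' (by linarith [hs.2]))
          ((hiff s hs.1).2 (hpos s ⟨hs.1.le, hs.2⟩))
    have h4 : 0 < t * hnKernel α γ t := by
      rw [mul_hnKernel hα hγ hγ' ht]
      exact mul_pos hμ h2
    exact pos_of_mul_pos_right h4 ht.le

lemma hasDerivAt_rlKernel (μ : ℝ) {t : ℝ} (ht : 0 < t) :
    HasDerivAt (rlKernel μ) ((μ - 1) * rlKernel μ t / t) t := by
  have h := (Real.hasDerivAt_rpow_const (x := t) (p := μ - 1) (Or.inl ht.ne')).div_const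
    (Real.Gamma μ)
  refine h.congr_deriv ?_
  rw [rlKernel, Real.rpow_sub_one ht.ne']
  ring

lemma hasDerivAt_fracSeries {a : ℕ → ℝ} (ha : ∀ n, |a n| ≤ n + 1) {α μ t : ℝ} (hα : 0 < α)
    (hμ : 0 < μ) (ht : 0 < t) :
    HasDerivAt (fracSeries a α μ)
      (∑' n : ℕ, a n * ((α * n + μ - 1) * rlKernel (α * n + μ) t / t)) t := by
  have hs := ((summable_rlKernel hα hμ (by positivity : 0 < 2 * t) 2).add
    (summable_rlKernel hα hμ (by positivity : 0 < t / 2) 2)).mul_left ((α + μ + 1) * (2 / t))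
  have hmem : t ∈ Ioo (t / 2) (2 * t) := ⟨by linarith, by linarith⟩
  refine hasDerivAt_tsum_of_isPreconnected (t := Ioo (t / 2) (2 * t)) hs isOpen_Ioo
    isPreconnected_Ioo (g := fun n s => a n * rlKernel (α * n + μ) s)
    (g' := fun n s => a n * ((α * n + μ - 1) * rlKernel (α * n + μ) s / s)) (fun n s hs => ?_)
    (fun n s hs => ?_) hmem (summable_fracSeries ha hα hμ ht).of_norm hmem
  · exact (hasDerivAt_rlKernel _ (by linarith [hs.1])).const_mul _
  · have hs0 : 0 < s := by linarith [hs.1]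
    have hidx : 0 < α * n + μ := by positivity
    have hG := Real.Gamma_pos_of_pos hidx
    have hle : rlKernel (α * n + μ) s ≤
        rlKernel (α * n + μ) (2 * t) + rlKernel (α * n + μ) (t / 2) := by
      rcases le_total 0 (α * n + μ - 1) with h | h
      · have h1 : rlKernel (α * n + μ) s ≤ rlKernel (α * n + μ) (2 * t) :=
          div_le_div_of_nonneg_right (Real.rpow_le_rpow hs0.le hs.2.le h) hG.le
        have h2 := rlKernel_nonneg hidx (by linarith : 0 ≤ t / 2)
        linarith
      · have h1 : rlKernel (α * n + μ) s ≤ rlKernel (α * n + μ) (t / 2) :=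
          div_le_div_of_nonneg_right (Real.rpow_le_rpow_of_nonpos (by linarith) hs.1.le h) hG.le
        have h2 := rlKernel_nonneg hidx (by linarith : 0 ≤ 2 * t)
        linarith
    have hk := rlKernel_nonneg hidx hs0.le
    have hfac : |α * n + μ - 1| ≤ (α + μ + 1) * (n + 1) := by
      rw [abs_le]
      constructor <;> nlinarith [mul_nonneg hα.le (Nat.cast_nonneg (α := ℝ) n),
        mul_nonneg hμ.le (Nat.cast_nonneg (α := ℝ) n), Nat.cast_nonneg (α := ℝ) n]
    have hinv : 1 / s ≤ 2 / t := by
      rw [div_le_div_iff₀ hs0 ht]; linarith [hs.1]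
    rw [norm_mul, norm_div, norm_mul, Real.norm_eq_abs, Real.norm_eq_abs, Real.norm_of_nonneg hk,
      Real.norm_of_nonneg hs0.le, div_eq_mul_one_div]
    calc |a n| * (|α * n + μ - 1| * rlKernel (α * n + μ) s * (1 / s))
        ≤ (n + 1) * (((α + μ + 1) * (n + 1)) *
          (rlKernel (α * n + μ) (2 * t) + rlKernel (α * n + μ) (t / 2)) * (2 / t)) := by
          have := ha n
          have := hk.trans hle
          have : 0 ≤ α + μ + 1 := by positivity
          gcongr
      _ = _ := by ring

/-- The derivative of the kernel: `-t k_γ' = (1 - αγ) k_γ + αγ k_{γ+1}`. -/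
lemma hasDerivAt_hnKernel {α γ t : ℝ} (hα : 0 < α) (hγ : 0 < γ) (hγ' : γ ≤ 1) (ht : 0 < t) :
    HasDerivAt (hnKernel α γ)
      (-((1 - α * γ) * hnKernel α γ t + α * γ * hnKernel α (γ + 1) t) / t) t := by
  have hμ : 0 < α * γ := mul_pos hα hγ
  have hb := abs_signedCoeff_le hγ (by linarith)
  have hb' := abs_signedCoeff_le (γ := γ + 1) (by linarith) (by linarith)
  refine (hasDerivAt_fracSeries hb hα hμ ht).congr_deriv ?_
  have hs := (summable_fracSeries hb hα hμ ht).of_norm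
  have hs' := (summable_fracSeries hb' hα (mul_pos hα (by linarith : 0 < γ + 1)) ht).of_norm
  have hshift : ∀ n : ℕ, signedCoeff γ (n + 1) * (α * (n + 1 : ℕ)) *
      rlKernel (α * (n + 1 : ℕ) + α * γ) t =
      -(α * γ) * (signedCoeff (γ + 1) n * rlKernel (α * n + α * (γ + 1)) t) := by
    intro n
    have h1 : α * ((n + 1 : ℕ) : ℝ) + α * γ = α * n + α * (γ + 1) := by push_cast; ring
    have h2 := binomCoeff_add_one γ n
    have h3 := binomCoeff_succ γ n
    rw [eq_div_iff (by positivity)] at h3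
    rw [h1]
    simp only [signedCoeff]
    push_cast
    rw [pow_succ]
    linear_combination (-(-1) ^ n * α * rlKernel (α * n + α * (γ + 1)) t) * (h3 - h2)
  have hsum0 : Summable fun n : ℕ => signedCoeff γ n * (α * n) *
      rlKernel (α * n + α * γ) t := by
    rw [← summable_nat_add_iff 1]
    exact (hs'.mul_left (-(α * γ))).congr fun n => (hshift n).symm
  have h0 : ∑' n : ℕ, signedCoeff γ n * (α * n) * rlKernel (α * n + α * γ) t =
      -(α * γ) * hnKernel α (γ + 1) t := by
    rw [hsum0.tsum_eq_zero_add, hnKernel, fracSeries, ← tsum_mul_left]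
    simp only [hshift]
    simp
  have h1 : ∑' n : ℕ, signedCoeff γ n * ((α * n + α * γ - 1) *
      rlKernel (α * n + α * γ) t / t) =
      ((∑' n : ℕ, signedCoeff γ n * (α * n) * rlKernel (α * n + α * γ) t) +
        (α * γ - 1) * hnKernel α γ t) * (1 / t) := by
    rw [hnKernel, fracSeries, ← tsum_mul_left, ← hsum0.tsum_add (hs.mul_left _), ← tsum_mul_right]
    refine tsum_congr fun n => ?_
    ring
  rw [h1, h0]
  ring

/-- The kernel with Laplace transform `(1 + s^α)^(-β)` is nonincreasing. -/
lemma antitoneOn_hnKernel {α β : ℝ} (hα : 0 < α) (hα' : α ≤ 1) (hβ : 0 < β) (hβ' : β ≤ 1) :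
    AntitoneOn (hnKernel α β) (Ioi 0) := by
  refine antitoneOn_of_deriv_nonpos (convex_Ioi 0) (fun t ht =>
    (hasDerivAt_hnKernel hα hβ hβ' ht).continuousAt.continuousWithinAt) ?_ ?_
  · rw [interior_Ioi]
    exact fun t ht => (hasDerivAt_hnKernel hα hβ hβ' ht).differentiableAt.differentiableWithinAt
  · rw [interior_Ioi]
    intro t ht
    have ht' : 0 < t := ht
    rw [(hasDerivAt_hnKernel hα hβ hβ' ht).deriv]
    have h1 := (hnKernel_pos hα hα' hβ (by linarith) ht').le
    have h2 := (hnKernel_pos (γ := β + 1) hα hα' (by linarith) (by linarith) ht').le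
    have h3 : 0 ≤ 1 - α * β := by nlinarith
    refine div_nonpos_of_nonpos_of_nonneg ?_ ht'.le
    have := mul_nonneg h3 h1
    have := mul_nonneg (mul_pos hα hβ).le h2
    linarith

lemma boundTerm_eq {α β T : ℝ} (hα : 0 < α) (hβ : 0 < β) (hT : 0 < T) (k : ℕ) :
    T ^ (α * β) * boundTerm α β T k =
      |signedCoeff β k| * rlKernel (α * k + (α * β + 1)) T := by
  have hx : 0 < α * k + α * β := by positivity
  have hG := Real.Gamma_pos_of_pos hx
  rw [boundTerm, rlKernel, ← add_assoc, Real.Gamma_add_one hx.ne', add_sub_cancel_right,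
    Real.rpow_add hT, abs_of_pos hG, abs_signedCoeff hβ, binomCoeff,
    abs_of_pos (ascPochhammer_pos k β hβ)]
  field_simp

lemma summable_boundTerm {α β T : ℝ} (hα : 0 < α) (hβ : 0 < β) (hβ' : β ≤ 1) (hT : 0 < T) :
    Summable (boundTerm α β T) := by
  have h := (summable_fracSeries (abs_signedCoeff_le hβ (by linarith : β ≤ 2)) hα
    (μ := α * β + 1) (by positivity) hT).mul_left (T ^ (α * β))⁻¹
  refine h.congr fun k => ?_
  have hp : 0 < T ^ (α * β) := Real.rpow_pos_of_pos hT _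
  rw [norm_mul, Real.norm_eq_abs, Real.norm_of_nonneg (rlKernel_nonneg (by positivity) hT.le),
    ← boundTerm_eq hα hβ hT]
  field_simp

lemma integral_hnKernel_le {α β T : ℝ} (hα : 0 < α) (hβ : 0 < β) (hβ' : β ≤ 1)
    (hT : 0 < T) : ∫ s in (0 : ℝ)..T, hnKernel α β s ≤ boundConst α β T := by
  have hb := abs_signedCoeff_le hβ (by linarith : β ≤ 2)
  have hμ : 0 < α * β + 1 := by positivity
  unfold hnKernel
  rw [integral_fracSeries hb hα (mul_pos hα hβ) hT, boundConst, ← tsum_mul_left]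
  simp only [boundTerm_eq hα hβ hT]
  have hs := summable_fracSeries hb hα hμ hT
  have heq : ∀ k : ℕ, ‖signedCoeff β k * rlKernel (α * k + (α * β + 1)) T‖ =
      |signedCoeff β k| * rlKernel (α * k + (α * β + 1)) T := fun k => by
    rw [norm_mul, Real.norm_eq_abs, Real.norm_of_nonneg (rlKernel_nonneg (by positivity) hT.le)]
  simp only [← heq]
  exact hs.of_norm.tsum_le_tsum (fun k => Real.le_norm_self _) hs

/-! ### Positivity of the memory term and energy lemmas -/

section

/-- A nonnegative nonincreasing weight preserves the nonnegativity of `∫₀ᵃ c` for all `a`. By the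
layer-cake formula the weight is a superposition of indicators of the intervals `(0, a)`. -/
lemma setIntegral_antitone_mul_nonneg {k c : ℝ → ℝ} {t : ℝ} (hk : AntitoneOn k (Ioi 0))
    (hk0 : ∀ x, 0 < x → 0 ≤ k x) (hc : IntegrableOn c (Ioc 0 t))
    (hkc : IntegrableOn (fun x => k x * c x) (Ioc 0 t))
    (hpos : ∀ a, 0 ≤ a → 0 ≤ ∫ x in Ioc 0 (min a t), c x) :
    0 ≤ ∫ x in Ioc 0 t, k x * c x := by
  set μ := volume.restrict (Ioc 0 t)
  set ν := (volume : Measure ℝ).restrict (Ioi 0)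
  have hkm : AEMeasurable k μ :=
    aemeasurable_restrict_of_antitoneOn measurableSet_Ioc (hk.mono fun x hx => hx.1)
  set S : Set (ℝ × ℝ) := {p | p.2 < k p.1}
  have hS : NullMeasurableSet S (μ.prod ν) :=
    nullMeasurableSet_lt measurable_snd.aemeasurable hkm.comp_fst
  set G : ℝ × ℝ → ℝ := S.indicator fun p => c p.1 with hG
  have hGm : AEStronglyMeasurable G (μ.prod ν) :=
    hc.aestronglyMeasurable.comp_fst.indicator₀ hS
  have hGx : ∀ x y, G (x, y) = (Iio (k x)).indicator (fun _ => c x) y := fun x y => rfl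
  have hvol : ∀ x ∈ Ioc 0 t, ν (Iio (k x)) = ENNReal.ofReal (k x) := by
    intro x hx
    rw [Measure.restrict_apply measurableSet_Iio, inter_comm, Ioi_inter_Iio, Real.volume_Ioo,
      sub_zero]
  have hGn : ∀ x y, ‖G (x, y)‖ = (Iio (k x)).indicator (fun _ => |c x|) y := by
    intro x y
    rw [hGx, norm_indicator_eq_indicator_norm]; rfl
  have hGint : Integrable G (μ.prod ν) := by
    rw [integrable_prod_iff hGm]
    constructor
    · filter_upwards [ae_restrict_mem measurableSet_Ioc] with x hx
      simp only [hGx]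
      rw [integrable_indicator_iff measurableSet_Iio]
      refine integrableOn_const ?_
      rw [hvol x hx]
      exact ENNReal.ofReal_ne_top
    · refine hkc.norm.congr ?_
      filter_upwards [ae_restrict_mem measurableSet_Ioc] with x hx
      simp only [hGn]
      rw [integral_indicator_const _ measurableSet_Iio, measureReal_def, hvol x hx,
        ENNReal.toReal_ofReal (hk0 x hx.1), norm_mul, Real.norm_of_nonneg (hk0 x hx.1)]
      rfl
  have hswap := integral_integral_swap (f := fun x y => G (x, y)) (μ := μ) (ν := ν) hGint
  have hleft : ∫ x in Ioc 0 t, k x * c x = ∫ x, ∫ y, G (x, y) ∂ν ∂μ := by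
    refine integral_congr_ae ?_
    filter_upwards [ae_restrict_mem measurableSet_Ioc] with x hx
    simp only [hGx]
    rw [integral_indicator_const _ measurableSet_Iio, measureReal_def, hvol x hx,
      ENNReal.toReal_ofReal (hk0 x hx.1)]
    rfl
  rw [hleft, hswap]
  refine integral_nonneg_of_ae ?_
  filter_upwards [ae_restrict_mem measurableSet_Ioi] with y hy
  -- the superlevel set of the weight is an interval with left end point `0`
  set A : Set ℝ := {x | x ∈ Ioc 0 t ∧ y < k x} with hA
  have hGA : ∫ x, G (x, y) ∂μ = ∫ x in A, c x := by
    have hAm : NullMeasurableSet {x | y < k x} μ := nullMeasurableSet_lt aemeasurable_const hkm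
    have : (fun x => G (x, y)) = {x | y < k x}.indicator c := rfl
    rw [this, integral_indicator₀ hAm, Measure.restrict_restrict₀ hAm]
    congr 2
    ext x
    simp [hA, and_comm]
  have hAe : ∃ a, 0 ≤ a ∧ A =ᵐ[volume] Ioc 0 (min a t) := by
    rcases A.eq_empty_or_nonempty with h | h
    · refine ⟨0, le_rfl, ?_⟩
      rw [h, Ioc_eq_empty (by simp)]
      exact Filter.EventuallyEq.rfl
    · have hbdd : BddAbove A := ⟨t, fun x hx => hx.1.2⟩
      have hat : sSup A ≤ t := csSup_le h fun x hx => hx.1.2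
      have ha0 : 0 ≤ sSup A := by
        obtain ⟨x, hx⟩ := h
        exact hx.1.1.le.trans (le_csSup hbdd hx)
      refine ⟨sSup A, ha0, ?_⟩
      rw [min_eq_left hat]
      refine (LE.le.eventuallyLE fun x hx => ?_).antisymm
        (Ioo_ae_eq_Ioc.symm.le.trans (LE.le.eventuallyLE fun x hx => ?_))
      · exact ⟨hx.1.1, le_csSup hbdd hx⟩
      · obtain ⟨z, hz, hxz⟩ := exists_lt_of_lt_csSup h hx.2
        exact ⟨⟨hx.1, hxz.le.trans hz.1.2⟩, hz.2.trans_le (hk hx.1 hz.1.1 hxz.le)⟩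
  obtain ⟨a, ha0, hAe⟩ := hAe
  simp only [Pi.zero_apply]
  rw [hGA, setIntegral_congr_set hAe]
  exact hpos a ha0

variable {X : Type*} [NormedAddCommGroup X] [InnerProductSpace ℝ X]

lemma integrable_conv_inner {J : ℝ → ℝ} {W : ℝ → X} (hJ : Integrable J) (hW : Integrable W)
    {U : ℝ → X} (hU : Continuous U) {C : ℝ} (hC : ∀ s, ‖U s‖ ≤ C) (t : ℝ) :
    Integrable (fun p : ℝ × ℝ => J p.2 * inner ℝ (W (p.1 - p.2)) (U p.1))
      ((volume.restrict (Ioc 0 t)).prod volume) ∧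
    ∀ᵐ s ∂(volume.restrict (Ioc 0 t)), Integrable fun x => J x • W (s - x) := by
  have h := Integrable.convolution_integrand (ContinuousLinearMap.lsmul ℝ ℝ : ℝ →L[ℝ] X →L[ℝ] X)
    hJ hW
  have hle : (volume.restrict (Ioc 0 t)).prod (volume : Measure ℝ) ≤
      (volume : Measure ℝ).prod volume := by
    rw [← Measure.restrict_univ (μ := (volume : Measure ℝ)), Measure.prod_restrict,
      Measure.restrict_univ]
    exact Measure.restrict_le_self
  have h' := h.mono_measure hle
  simp only [ContinuousLinearMap.lsmul_apply] at h'
  refine ⟨?_, h'.prod_right_ae⟩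
  refine (h'.norm.mul_const C).mono'
    ?_ (Eventually.of_forall fun p => ?_)
  · have := h'.aestronglyMeasurable.inner (𝕜 := ℝ)
      ((hU.comp continuous_fst).aestronglyMeasurable
        (μ := (volume.restrict (Ioc 0 t)).prod (volume : Measure ℝ)))
    refine this.congr (Eventually.of_forall fun p => ?_)
    simp only [Function.comp, real_inner_smul_left]
  · rw [← real_inner_smul_left]
    exact (norm_inner_le_norm _ _).trans (mul_le_mul_of_nonneg_left (hC _) (norm_nonneg _))

/-- Pairing a convolution `J * W` with `U` amounts to weighting the correlation of `W` and `U`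
with `J`. -/
lemma integral_conv_inner [CompleteSpace X] {J : ℝ → ℝ} {W : ℝ → X} (hJ : Integrable J)
    (hW : Integrable W)
    {U : ℝ → X} (hU : Continuous U) {C : ℝ} (hC : ∀ s, ‖U s‖ ≤ C) (t : ℝ) :
    Integrable (fun x => J x * ∫ s in Ioc 0 t, inner ℝ (W (s - x)) (U s)) ∧
    ∫ s in Ioc 0 t, inner ℝ (∫ x, J x • W (s - x)) (U s) =
      ∫ x, J x * ∫ s in Ioc 0 t, inner ℝ (W (s - x)) (U s) := by
  obtain ⟨h1, h2⟩ := integrable_conv_inner hJ hW hU hC t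
  constructor
  · refine h1.integral_prod_right.congr (Eventually.of_forall fun x => ?_)
    simp only [integral_const_mul]
  · have hswap := integral_integral_swap
      (f := fun s x => J x * inner ℝ (W (s - x)) (U s)) (μ := volume.restrict (Ioc 0 t))
      (ν := volume) h1
    simp only [integral_const_mul] at hswap
    rw [← hswap]
    refine integral_congr_ae ?_
    filter_upwards [h2] with s hs
    rw [real_inner_comm (U s)]
    refine (integral_inner (𝕜 := ℝ) hs (U s)).symm.trans
      (integral_congr_ae (Eventually.of_forall fun x => ?_))
    simp only [real_inner_smul_right]
    rw [real_inner_comm (U s)]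

lemma continuous_primitive {W : ℝ → X} (hW : Integrable W) :
    Continuous fun s => ∫ r in (0 : ℝ)..s, W r :=
  intervalIntegral.continuous_primitive (fun _ _ => hW.intervalIntegrable) 0

lemma norm_primitive_le {W : ℝ → X} (hW : Integrable W) (s : ℝ) :
    ‖∫ r in (0 : ℝ)..s, W r‖ ≤ ∫ r, ‖W r‖ :=
  intervalIntegral.norm_integral_le_integral_norm_uIoc.trans
    (setIntegral_le_integral hW.norm (Eventually.of_forall fun _ => norm_nonneg _))

lemma primitive_eq_zero {W : ℝ → X} (hW0 : ∀ r, r ≤ 0 → W r = 0) {s : ℝ} (hs : s ≤ 0) :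
    ∫ r in (0 : ℝ)..s, W r = 0 := by
  rw [intervalIntegral.integral_zero_ae]
  refine Eventually.of_forall fun r hr => hW0 r ?_
  rw [uIoc_of_ge hs] at hr
  exact hr.2

/-- Time differences `U(s) - U(s - a)` of a causal function pair nonnegatively with `U`. -/
lemma integral_sub_translate_nonneg {U : ℝ → X} (hU : Continuous U) (hU0 : ∀ s, s ≤ 0 → U s = 0)
    {a t : ℝ} (ha : 0 ≤ a) (ht : 0 ≤ t) :
    0 ≤ ∫ s in (0 : ℝ)..t, inner ℝ (U s - U (s - a)) (U s) := by
  have hii : ∀ x y : ℝ, IntervalIntegrable (fun s => ‖U s‖ ^ 2) volume x y := fun x y =>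
    (hU.norm.pow 2).intervalIntegrable x y
  have hshift : ∫ s in (0 : ℝ)..t, ‖U (s - a)‖ ^ 2 ≤ ∫ s in (0 : ℝ)..t, ‖U s‖ ^ 2 := by
    rw [intervalIntegral.integral_comp_sub_right (fun s => ‖U s‖ ^ 2)]
    have h1 := intervalIntegral.integral_add_adjacent_intervals (hii (0 - a) 0) (hii 0 (t - a))
    have h2 := intervalIntegral.integral_add_adjacent_intervals (hii 0 (t - a)) (hii (t - a) t)
    have h3 : ∫ s in (0 - a)..0, ‖U s‖ ^ 2 = 0 := by
      rw [intervalIntegral.integral_congr (g := fun _ => 0)]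
      · simp
      · intro s hs
        rw [uIcc_of_le (by linarith)] at hs
        simp [hU0 s hs.2]
    have h4 : 0 ≤ ∫ s in (t - a)..t, ‖U s‖ ^ 2 :=
      intervalIntegral.integral_nonneg (by linarith) fun s _ => by positivity
    linarith
  have hle : ∫ s in (0 : ℝ)..t, (1 / 2 * ‖U s‖ ^ 2 - 1 / 2 * ‖U (s - a)‖ ^ 2) ≤
      ∫ s in (0 : ℝ)..t, inner ℝ (U s - U (s - a)) (U s) := by
    refine intervalIntegral.integral_mono_on ht ?_ ?_ fun s _ => ?_
    · exact Continuous.intervalIntegrable (by fun_prop) _ _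
    · exact Continuous.intervalIntegrable (by fun_prop) _ _
    · rw [inner_sub_left, real_inner_self_eq_norm_sq]
      have := real_inner_le_norm (U (s - a)) (U s)
      nlinarith [sq_nonneg (‖U (s - a)‖ - ‖U s‖)]
  rw [intervalIntegral.integral_sub, intervalIntegral.integral_const_mul,
    intervalIntegral.integral_const_mul] at hle
  · linarith
  · exact Continuous.intervalIntegrable (by fun_prop) _ _
  · exact Continuous.intervalIntegrable (by fun_prop) _ _

/-- Positivity of the memory term: for a nonnegative nonincreasing kernel `k` and a causal `W` with
primitive `U`, the pairing of `k * W = (k * U)'` with `U` has nonnegative integral. -/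
lemma integral_memory_inner_nonneg [CompleteSpace X] {k : ℝ → ℝ} {W : ℝ → X} {t : ℝ} (ht : 0 ≤ t)
    (hk : AntitoneOn k (Ioi 0)) (hk0 : ∀ x, 0 < x → 0 ≤ k x) (hki : IntegrableOn k (Ioc 0 t))
    (hW : Integrable W) (hW0 : ∀ r, r ≤ 0 → W r = 0) :
    0 ≤ ∫ s in (0 : ℝ)..t,
      inner ℝ (∫ r in (0 : ℝ)..s, k (s - r) • W r) (∫ r in (0 : ℝ)..s, W r) := by
  set U : ℝ → X := fun s => ∫ r in (0 : ℝ)..s, W r with hUdef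
  have hU : Continuous U := continuous_primitive hW
  have hUb : ∀ s, ‖U s‖ ≤ ∫ r, ‖W r‖ := norm_primitive_le hW
  have hU0 : ∀ s, s ≤ 0 → U s = 0 := fun s hs => primitive_eq_zero hW0 hs
  set c : ℝ → ℝ := fun x => ∫ s in Ioc 0 t, inner ℝ (W (s - x)) (U s) with hcdef
  have hind : ∀ (A : Set ℝ) (f : ℝ → ℝ) (x : ℝ),
      A.indicator f x * c x = A.indicator (fun x => f x * c x) x := by
    intro A f x
    by_cases h : x ∈ A <;> simp [h]
  -- the convolution with the truncated kernel
  have hK : Integrable (fun x => (Ioc 0 t).indicator k x * c x) ∧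
      ∫ s in Ioc 0 t, inner ℝ (∫ x, (Ioc 0 t).indicator k x • W (s - x)) (U s) =
        ∫ x, (Ioc 0 t).indicator k x * c x :=
    integral_conv_inner (hki.integrable_indicator measurableSet_Ioc) hW hU hUb t
  simp only [hind] at hK
  rw [integrable_indicator_iff measurableSet_Ioc, integral_indicator measurableSet_Ioc] at hK
  have hone : ∀ a : ℝ, Integrable ((Ioc 0 a).indicator fun _ => (1 : ℝ)) := fun a =>
    (integrableOn_const (by simp)).integrable_indicator measurableSet_Ioc
  have hJ : ∀ a : ℝ, Integrable (fun x => (Ioc 0 a).indicator (fun _ => (1 : ℝ)) x * c x) ∧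
      ∫ s in Ioc 0 t, inner ℝ (∫ x, (Ioc 0 a).indicator (fun _ => (1 : ℝ)) x • W (s - x)) (U s) =
        ∫ x, (Ioc 0 a).indicator (fun _ => (1 : ℝ)) x * c x :=
    fun a => integral_conv_inner (hone a) hW hU hUb t
  simp only [hind, one_mul] at hJ
  have hc : IntegrableOn c (Ioc 0 t) := by
    have := (hJ t).1
    rwa [integrable_indicator_iff measurableSet_Ioc] at this
  have hconv : ∀ s ∈ Ioc 0 t, ∫ r in (0 : ℝ)..s, k (s - r) • W r =
      ∫ x, (Ioc 0 t).indicator k x • W (s - x) := by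
    intro s hs
    rw [← integral_sub_left_eq_self (fun x => (Ioc 0 t).indicator k x • W (s - x)) volume s,
      intervalIntegral.integral_of_le hs.1.le, integral_Ioc_eq_integral_Ioo,
      ← integral_indicator measurableSet_Ioo]
    congr 1
    funext r
    simp only [sub_sub_cancel]
    by_cases hr : r ∈ Ioo 0 s
    · rw [indicator_of_mem hr, indicator_of_mem]
      exact ⟨by linarith [hr.2], by linarith [hr.1, hs.2]⟩
    · rw [indicator_of_notMem hr]
      rcases le_or_gt r 0 with h | h
      · rw [hW0 r h, smul_zero]
      · rw [indicator_of_notMem, zero_smul]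
        intro h'
        exact hr ⟨h, by linarith [h'.1]⟩
  rw [intervalIntegral.integral_of_le ht, setIntegral_congr_fun (g := fun s =>
    inner ℝ (∫ x, (Ioc 0 t).indicator k x • W (s - x)) (U s)) measurableSet_Ioc
    (fun s hs => by simp only [hconv s hs, hUdef]), hK.2]
  refine setIntegral_antitone_mul_nonneg hk hk0 hc hK.1 fun a ha => ?_
  set b := min a t
  have hb : 0 ≤ b := le_min ha ht
  have hJb := (hJ b).2
  rw [integral_indicator measurableSet_Ioc] at hJb
  rw [← hJb, ← intervalIntegral.integral_of_le ht]
  have hdiff : ∀ s, ∫ x, (Ioc 0 b).indicator (fun _ => (1 : ℝ)) x • W (s - x) =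
      U s - U (s - b) := by
    intro s
    have : (fun x => (Ioc 0 b).indicator (fun _ => (1 : ℝ)) x • W (s - x)) =
        (Ioc 0 b).indicator fun x => W (s - x) := by
      funext x
      by_cases h : x ∈ Ioc 0 b <;> simp [h]
    rw [this, integral_indicator measurableSet_Ioc, ← intervalIntegral.integral_of_le hb,
      intervalIntegral.integral_comp_sub_left, sub_zero, hUdef,
      intervalIntegral.integral_interval_sub_left hW.intervalIntegrable hW.intervalIntegrable]
  simp only [hdiff]
  exact integral_sub_translate_nonneg hU hU0 hb ht

/-- The chain rule `∫₀ᵗ (U', U) = ‖U(t)‖² / 2` for the primitive `U` of an integrable function,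
obtained from the symmetry of `(W(s), W(r))` on the square `(0, t)²`. -/
lemma integral_inner_primitive [CompleteSpace X] {W : ℝ → X} (hW : Integrable W) {t : ℝ}
    (ht : 0 ≤ t) :
    ∫ s in (0 : ℝ)..t, inner ℝ (W s) (∫ r in (0 : ℝ)..s, W r) =
      1 / 2 * ‖∫ r in (0 : ℝ)..t, W r‖ ^ 2 := by
  set μ := (volume : Measure ℝ).restrict (Ioc 0 t)
  have hWμ : Integrable W μ := hW.mono_measure Measure.restrict_le_self
  set F : ℝ × ℝ → ℝ := fun p => inner ℝ (W p.1) (W p.2) with hF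
  have hFi : Integrable F (μ.prod μ) := by
    refine (hWμ.norm.mul_prod hWμ.norm).mono' ?_ (Eventually.of_forall fun p => ?_)
    · exact hWμ.aestronglyMeasurable.comp_fst.inner hWμ.aestronglyMeasurable.comp_snd
    · exact norm_inner_le_norm _ _
  set S : Set (ℝ × ℝ) := {p | p.2 ≤ p.1} with hSdef
  have hS : MeasurableSet S := measurableSet_le measurable_snd measurable_fst
  set S' : Set (ℝ × ℝ) := {p | p.1 ≤ p.2} with hSdef'
  have hS' : MeasurableSet S' := measurableSet_le measurable_fst measurable_snd
  have hdiag : ∀ᵐ p ∂(μ.prod μ), p.1 ≠ p.2 := by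
    rw [Measure.ae_prod_iff_ae_ae]
    · refine Eventually.of_forall fun x => ?_
      have : ∀ᵐ y ∂μ, y ≠ x := ae_restrict_of_ae (Measure.ae_ne volume x)
      filter_upwards [this] with y hy using hy.symm
    · exact (measurableSet_eq_fun measurable_fst measurable_snd).compl
  have hsplit : ∫ p, F p ∂(μ.prod μ) =
      (∫ p in S, F p ∂(μ.prod μ)) + ∫ p in S', F p ∂(μ.prod μ) := by
    rw [← integral_add_compl hS hFi]
    congr 1
    refine setIntegral_congr_set ?_
    filter_upwards [hdiag] with p hp
    have : (p ∈ Sᶜ) = (p ∈ S') := by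
      simp only [hSdef, hSdef', mem_compl_iff, mem_ofPred_eq, not_le, eq_iff_iff]
      exact ⟨le_of_lt, fun h => lt_of_le_of_ne h hp⟩
    exact this
  have hsym : ∫ p in S', F p ∂(μ.prod μ) = ∫ p in S, F p ∂(μ.prod μ) := by
    rw [← integral_indicator hS, ← integral_indicator hS', ← integral_prod_swap]
    congr 1
    funext p
    by_cases h : p.2 ≤ p.1
    · rw [indicator_of_mem (show p.swap ∈ S' from h), indicator_of_mem (show p ∈ S from h)]
      exact real_inner_comm _ _
    · rw [indicator_of_notMem (show p.swap ∉ S' from h), indicator_of_notMem (show p ∉ S from h)]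
  have hfull : ∫ p, F p ∂(μ.prod μ) = ‖∫ r in (0 : ℝ)..t, W r‖ ^ 2 := by
    rw [integral_prod _ hFi]
    simp only [hF]
    have : ∀ s, ∫ r, inner ℝ (W s) (W r) ∂μ = inner ℝ (W s) (∫ r, W r ∂μ) := fun s =>
      integral_inner hWμ _
    simp only [this]
    rw [← real_inner_self_eq_norm_sq, intervalIntegral.integral_of_le ht]
    simp_rw [real_inner_comm (∫ r, W r ∂μ)]
    exact integral_inner hWμ _
  have hhalf : ∫ s in (0 : ℝ)..t, inner ℝ (W s) (∫ r in (0 : ℝ)..s, W r) =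
      ∫ p in S, F p ∂(μ.prod μ) := by
    rw [← integral_indicator hS, integral_prod _ (hFi.indicator hS),
      intervalIntegral.integral_of_le ht]
    refine setIntegral_congr_fun measurableSet_Ioc fun s hs => ?_
    have : (fun r => S.indicator F (s, r)) = (Iic s).indicator fun r => inner ℝ (W s) (W r) := by
      funext r
      by_cases h : r ≤ s
      · rw [indicator_of_mem (show (s, r) ∈ S from h), indicator_of_mem (show r ∈ Iic s from h)]
      · rw [indicator_of_notMem (show (s, r) ∉ S from h),
          indicator_of_notMem (show r ∉ Iic s from h)]
    rw [this, integral_indicator measurableSet_Iic, Measure.restrict_restrict measurableSet_Iic,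
      inter_comm, Ioc_inter_Iic, min_eq_right hs.2, intervalIntegral.integral_of_le hs.1.le]
    exact (integral_inner (hW.mono_measure Measure.restrict_le_self) _).symm
  rw [hhalf]
  linarith

/-- A nonlinear Grönwall inequality: `n(t)² ≤ 2 c ∫₀ᵗ n` forces `n(t) ≤ c t`. -/
lemma le_mul_of_sq_le_integral {n : ℝ → ℝ} (hn : Continuous n) {c τ : ℝ} (hn0 : ∀ t, 0 ≤ n t)
    (hc : 0 ≤ c)
    (h : ∀ t ∈ Icc 0 τ, n t ^ 2 ≤ 2 * c * ∫ s in (0 : ℝ)..t, n s) {t : ℝ} (ht : t ∈ Icc 0 τ) :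
    n t ≤ c * t := by
  set F : ℝ → ℝ := fun t => ∫ s in (0 : ℝ)..t, n s with hF
  have hF0 : ∀ s, 0 ≤ s → 0 ≤ F s := fun s hs =>
    intervalIntegral.integral_nonneg hs fun r _ => hn0 r
  have hFd : ∀ s, HasDerivAt F (n s) s := fun s =>
    intervalIntegral.integral_hasDerivAt_right (hn.intervalIntegrable _ _)
      (hn.stronglyMeasurableAtFilter _ _) hn.continuousAt
  -- `√(F + ε)` grows at rate at most `√(c / 2)`
  have key : ∀ ε > 0, √(F t + ε) ≤ √ε + √(c / 2) * t := by
    intro ε hε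
    have hd : ∀ s, 0 ≤ s → HasDerivAt (fun s => √(F s + ε)) (n s / (2 * √(F s + ε))) s :=
      fun s hs => ((hFd s).add_const ε).sqrt (by linarith [hF0 s hs])
    have := (convex_Icc 0 t).image_sub_le_mul_sub_of_deriv_le (f := fun s => √(F s + ε))
      (C := √(c / 2)) (fun s hs => (hd s hs.1).continuousAt.continuousWithinAt)
      (fun s hs => by
        rw [interior_Icc] at hs
        exact (hd s hs.1.le).differentiableAt.differentiableWithinAt) ?_ 0 ⟨le_rfl, ht.1⟩ t
      ⟨ht.1, le_rfl⟩ ht.1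
    · have hz : F 0 = 0 := intervalIntegral.integral_same
      simp only [hz, zero_add, sub_zero] at this
      linarith
    · intro s hs
      rw [interior_Icc] at hs
      rw [(hd s hs.1.le).deriv]
      have hFs := hF0 s hs.1.le
      have hpos : 0 < √(F s + ε) := Real.sqrt_pos.2 (by linarith)
      rw [div_le_iff₀ (by positivity)]
      refine le_of_sq_le_sq ?_ (by positivity)
      have h1 := h s ⟨hs.1.le, hs.2.le.trans ht.2⟩
      have h2 : (√(c / 2) * (2 * √(F s + ε))) ^ 2 = 2 * c * (F s + ε) := by
        rw [mul_pow, mul_pow, Real.sq_sqrt (by positivity), Real.sq_sqrt (by linarith)]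
        ring
      rw [h2]
      nlinarith [mul_nonneg hc hε.le]
  have hlim : √(F t) ≤ √(c / 2) * t := by
    have h1 : Tendsto (fun ε => √(F t + ε)) (𝓝[>] 0) (𝓝 (√(F t + 0))) :=
      (Continuous.tendsto (by fun_prop) 0).mono_left nhdsWithin_le_nhds
    have h2 : Tendsto (fun ε => √ε + √(c / 2) * t) (𝓝[>] 0) (𝓝 (√0 + √(c / 2) * t)) :=
      (Continuous.tendsto (by fun_prop) 0).mono_left nhdsWithin_le_nhds
    have := le_of_tendsto_of_tendsto h1 h2 (by
      filter_upwards [self_mem_nhdsWithin] with ε hε using key ε hε)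
    simpa using this
  have hFt : F t ≤ c / 2 * t ^ 2 := by
    have := pow_le_pow_left₀ (Real.sqrt_nonneg _) hlim 2
    rwa [Real.sq_sqrt (hF0 t ht.1), mul_pow, Real.sq_sqrt (by positivity)] at this
  refine le_of_sq_le_sq ?_ (mul_nonneg hc ht.1)
  have := h t ht
  have h3 := mul_le_mul_of_nonneg_left hFt hc
  nlinarith

end

/-! ### The curl: duality and density -/

section

lemma inner_E3 (x y : E3) : inner ℝ x y = x 0 * y 0 + x 1 * y 1 + x 2 * y 2 := by
  simp [PiLp.inner_apply, Fin.sum_univ_three, mul_comm]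

lemma curl_zero_coord (φ : E3 → E3) (x : E3) : curl φ x 0 = pderiv φ 1 2 x - pderiv φ 2 1 x := rfl

lemma curl_one_coord (φ : E3 → E3) (x : E3) : curl φ x 1 = pderiv φ 2 0 x - pderiv φ 0 2 x := rfl

lemma curl_two_coord (φ : E3 → E3) (x : E3) : curl φ x 2 = pderiv φ 0 1 x - pderiv φ 1 0 x := rfl

lemma pderiv_add {φ ψ : E3 → E3} (hφ : Differentiable ℝ φ) (hψ : Differentiable ℝ ψ) (i j : Fin 3)
    (x : E3) : pderiv (φ + ψ) i j x = pderiv φ i j x + pderiv ψ i j x := by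
  simp [pderiv, fderiv_add (hφ x) (hψ x)]

lemma pderiv_smul {φ : E3 → E3} (hφ : Differentiable ℝ φ) (c : ℝ) (i j : Fin 3) (x : E3) :
    pderiv (c • φ) i j x = c * pderiv φ i j x := by
  simp [pderiv, fderiv_const_smul (hφ x)]

lemma curl_add {φ ψ : E3 → E3} (hφ : Differentiable ℝ φ) (hψ : Differentiable ℝ ψ) :
    curl (φ + ψ) = curl φ + curl ψ := by
  funext x
  ext i
  fin_cases i <;> simp [curl, pderiv_add hφ hψ] <;> ring

lemma curl_smul {φ : E3 → E3} (hφ : Differentiable ℝ φ) (c : ℝ) : curl (c • φ) = c • curl φ := by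
  funext x
  ext i
  fin_cases i <;> simp [curl, pderiv_smul hφ] <;> ring

lemma pderiv_eq {φ : E3 → E3} (hφ : Differentiable ℝ φ) (i j : Fin 3) (x : E3) :
    pderiv φ i j x = fderiv ℝ (fun y => φ y j) x (EuclideanSpace.single i 1) := by
  have h := ((EuclideanSpace.proj (𝕜 := ℝ) j).hasFDerivAt (x := φ x)).comp x (hφ x).hasFDerivAt
  have h' : HasFDerivAt (fun y => φ y j) ((EuclideanSpace.proj (𝕜 := ℝ) j).comp (fderiv ℝ φ x)) x :=
    h
  rw [h'.fderiv]
  rfl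

lemma curl_eq_zero_of_notMem_tsupport {φ : E3 → E3} {x : E3} (hx : x ∉ tsupport φ) :
    curl φ x = 0 := by
  have h0 : fderiv ℝ φ x = 0 := by
    by_contra hne
    exact hx (tsupport_fderiv_subset ℝ (subset_tsupport _ hne))
  ext i
  fin_cases i <;> simp [curl, pderiv, h0]

variable {Ω : Set E3}

namespace IsTestField

variable {φ ψ : E3 → E3}

lemma differentiable (h : IsTestField Ω φ) : Differentiable ℝ φ :=
  h.1.differentiable (by simp)

lemma add (h : IsTestField Ω φ) (h' : IsTestField Ω ψ) : IsTestField Ω (φ + ψ) :=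
  ⟨h.1.add h'.1, h.2.1.add h'.2.1,
    (tsupport_add φ ψ).trans (union_subset h.2.2 h'.2.2)⟩

lemma smul (h : IsTestField Ω φ) (c : ℝ) : IsTestField Ω (c • φ) :=
  ⟨h.1.const_smul c, h.2.1.smul_left (f := fun _ => c),
    (tsupport_smul_subset_right (fun _ => c) φ).trans h.2.2⟩

lemma continuous_pderiv (h : IsTestField Ω φ) (i j : Fin 3) : Continuous (pderiv φ i j) := by
  have : Continuous fun x => fderiv ℝ φ x (EuclideanSpace.single i 1) :=
    (h.1.continuous_fderiv (by simp)).clm_apply continuous_const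
  exact (EuclideanSpace.proj (𝕜 := ℝ) j).continuous.comp this

lemma hasCompactSupport_pderiv (h : IsTestField Ω φ) (i j : Fin 3) :
    HasCompactSupport (pderiv φ i j) :=
  (h.2.1.fderiv_apply ℝ (EuclideanSpace.single i 1)).comp_left
    (g := fun v : E3 => v j) rfl

lemma continuous_coord (h : IsTestField Ω φ) (j : Fin 3) : Continuous fun x => φ x j :=
  (EuclideanSpace.proj (𝕜 := ℝ) j).continuous.comp h.1.continuous

lemma hasCompactSupport_coord (h : IsTestField Ω φ) (j : Fin 3) :
    HasCompactSupport fun x => φ x j :=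
  h.2.1.comp_left (g := fun v : E3 => v j) rfl

lemma continuous_curl (h : IsTestField Ω φ) : Continuous (curl φ) := by
  refine (PiLp.continuous_toLp 2 _).comp (continuous_pi fun i => ?_)
  fin_cases i
  · exact (h.continuous_pderiv 1 2).sub (h.continuous_pderiv 2 1)
  · exact (h.continuous_pderiv 2 0).sub (h.continuous_pderiv 0 2)
  · exact (h.continuous_pderiv 0 1).sub (h.continuous_pderiv 1 0)

lemma hasCompactSupport_curl (h : IsTestField Ω φ) : HasCompactSupport (curl φ) :=
  HasCompactSupport.intro h.2.1 fun _ hx => curl_eq_zero_of_notMem_tsupport hx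

lemma memLp (h : IsTestField Ω φ) : MemLp φ 2 (volume.restrict Ω) :=
  h.1.continuous.memLp_of_hasCompactSupport h.2.1

lemma memLp_curl (h : IsTestField Ω φ) : MemLp (curl φ) 2 (volume.restrict Ω) :=
  h.continuous_curl.memLp_of_hasCompactSupport h.hasCompactSupport_curl

lemma mem_testGraph (h : IsTestField Ω φ) :
    (h.memLp.toLp φ, h.memLp_curl.toLp (curl φ)) ∈ testGraph Ω :=
  ⟨φ, h, h.memLp.coeFn_toLp, h.memLp_curl.coeFn_toLp⟩

end IsTestField

/-- Integration by parts for test fields: `∂ᵢ` is antisymmetric. -/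
lemma integral_coord_mul_pderiv {φ ψ : E3 → E3} (hφ : IsTestField Ω φ) (hψ : IsTestField Ω ψ)
    (i j k : Fin 3) : ∫ x, φ x j * pderiv ψ i k x = -∫ x, pderiv φ i j x * ψ x k := by
  simp only [pderiv_eq hφ.differentiable, pderiv_eq hψ.differentiable]
  refine integral_mul_fderiv_eq_neg_fderiv_mul_of_integrable ?_ ?_ ?_
    (fun x _ => ?_) (fun x _ => ?_)
  · simp only [← pderiv_eq hφ.differentiable]
    exact ((hφ.continuous_pderiv i j).mul (hψ.continuous_coord k)).integrable_of_hasCompactSupport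
      (hφ.hasCompactSupport_pderiv i j).mul_right
  · simp only [← pderiv_eq hψ.differentiable]
    exact ((hφ.continuous_coord j).mul (hψ.continuous_pderiv i k)).integrable_of_hasCompactSupport
      (hφ.hasCompactSupport_coord j).mul_right
  · exact ((hφ.continuous_coord j).mul (hψ.continuous_coord k)).integrable_of_hasCompactSupport
      (hφ.hasCompactSupport_coord j).mul_right
  · exact (EuclideanSpace.proj (𝕜 := ℝ) j).differentiableAt.comp x (hφ.differentiable x)
  · exact (EuclideanSpace.proj (𝕜 := ℝ) k).differentiableAt.comp x (hψ.differentiable x)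

/-- The curl is symmetric on test fields. -/
lemma integral_inner_curl {φ ψ : E3 → E3} (hφ : IsTestField Ω φ) (hψ : IsTestField Ω ψ) :
    ∫ x in Ω, inner ℝ (φ x) (curl ψ x) = ∫ x in Ω, inner ℝ (curl φ x) (ψ x) := by
  have hz : ∀ {χ : E3 → E3}, IsTestField Ω χ → ∀ x, x ∉ Ω → χ x = 0 := fun h x hx =>
    image_eq_zero_of_notMem_tsupport fun h' => hx (h.2.2 h')
  rw [setIntegral_eq_integral_of_forall_compl_eq_zero fun x hx => by simp [hz hφ x hx],
    setIntegral_eq_integral_of_forall_compl_eq_zero fun x hx => by simp [hz hψ x hx]]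
  have hi1 : ∀ i j k, Integrable fun x => φ x j * pderiv ψ i k x := fun i j k =>
    ((hφ.continuous_coord j).mul (hψ.continuous_pderiv i k)).integrable_of_hasCompactSupport
      (hφ.hasCompactSupport_coord j).mul_right
  have hi2 : ∀ i j k, Integrable fun x => pderiv φ i j x * ψ x k := fun i j k =>
    ((hφ.continuous_pderiv i j).mul (hψ.continuous_coord k)).integrable_of_hasCompactSupport
      (hφ.hasCompactSupport_pderiv i j).mul_right
  have hL : ∀ x, inner ℝ (φ x) (curl ψ x) =
      (φ x 0 * pderiv ψ 1 2 x - φ x 0 * pderiv ψ 2 1 x) +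
      (φ x 1 * pderiv ψ 2 0 x - φ x 1 * pderiv ψ 0 2 x) +
      (φ x 2 * pderiv ψ 0 1 x - φ x 2 * pderiv ψ 1 0 x) := fun x => by
    rw [inner_E3, curl_zero_coord, curl_one_coord, curl_two_coord]; ring
  have hR : ∀ x, inner ℝ (curl φ x) (ψ x) =
      (pderiv φ 1 2 x * ψ x 0 - pderiv φ 2 1 x * ψ x 0) +
      (pderiv φ 2 0 x * ψ x 1 - pderiv φ 0 2 x * ψ x 1) +
      (pderiv φ 0 1 x * ψ x 2 - pderiv φ 1 0 x * ψ x 2) := fun x => by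
    rw [inner_E3, curl_zero_coord, curl_one_coord, curl_two_coord]; ring
  simp only [hL, hR]
  have hsplit : ∀ a b c d e f : E3 → ℝ, Integrable a → Integrable b → Integrable c →
      Integrable d → Integrable e → Integrable f →
      ∫ x, ((a x - b x) + (c x - d x) + (e x - f x)) =
        ((∫ x, a x) - ∫ x, b x) + ((∫ x, c x) - ∫ x, d x) + ((∫ x, e x) - ∫ x, f x) := by
    intro a b c d e f ha hb hc hd he hf
    have h1 : Integrable fun x => a x - b x := ha.sub hb
    have h2 : Integrable fun x => c x - d x := hc.sub hd
    have h3 : Integrable fun x => e x - f x := he.sub hf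
    have h12 : Integrable fun x => (a x - b x) + (c x - d x) := h1.add h2
    rw [integral_add h12 h3, integral_add h1 h2, integral_sub ha hb, integral_sub hc hd,
      integral_sub he hf]
  rw [hsplit _ _ _ _ _ _ (hi1 _ _ _) (hi1 _ _ _) (hi1 _ _ _) (hi1 _ _ _) (hi1 _ _ _) (hi1 _ _ _),
    hsplit _ _ _ _ _ _ (hi2 _ _ _) (hi2 _ _ _) (hi2 _ _ _) (hi2 _ _ _) (hi2 _ _ _) (hi2 _ _ _)]
  simp only [integral_coord_mul_pderiv hφ hψ]
  ring

/-- The graph of the curl on test fields, as a subspace of `L² × L²`. -/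
def testSubmodule (Ω : Set E3) : Submodule ℝ (VecL2 Ω × VecL2 Ω) where
  carrier := testGraph Ω
  zero_mem' := ⟨0, ⟨contDiff_const, HasCompactSupport.zero, by simp [tsupport]⟩,
    Lp.coeFn_zero _ _ _, by
      have : curl 0 = 0 := by
        funext x
        ext i
        fin_cases i <;> simp [curl, pderiv]
      rw [this]
      exact Lp.coeFn_zero _ _ _⟩
  add_mem' := by
    rintro p q ⟨φ, hφ, h1, h2⟩ ⟨ψ, hψ, h3, h4⟩
    refine ⟨φ + ψ, hφ.add hψ, (Lp.coeFn_add _ _).trans (h1.add h3), ?_⟩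
    rw [curl_add hφ.differentiable hψ.differentiable]
    exact (Lp.coeFn_add _ _).trans (h2.add h4)
  smul_mem' := by
    rintro c p ⟨φ, hφ, h1, h2⟩
    refine ⟨c • φ, hφ.smul c, (Lp.coeFn_smul _ _).trans (h1.const_smul c), ?_⟩
    rw [curl_smul hφ.differentiable]
    exact (Lp.coeFn_smul _ _).trans (h2.const_smul c)

/-- A pair annihilated by everything orthogonal to a subspace lies in the closure of that
subspace. -/
lemma mem_closure_of_forall_orthogonal {V : Type*} [NormedAddCommGroup V] [InnerProductSpace ℝ V]
    [CompleteSpace V] (S : Submodule ℝ (V × V)) (x y : V)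
    (h : ∀ a b : V, (∀ p ∈ S, inner ℝ a p.1 + inner ℝ b p.2 = 0) →
      inner ℝ a x + inner ℝ b y = 0) : (x, y) ∈ closure (S : Set (V × V)) := by
  by_contra hcon
  obtain ⟨f, u, hfs, hfx⟩ := geometric_hahn_banach_closed_point
    S.topologicalClosure.convex S.isClosed_topologicalClosure (x := (x, y)) hcon
  have hvan : ∀ p ∈ S, f p = 0 := by
    intro p hp
    by_contra hne
    have h1 := hfs (((u + 1) / f p) • p)
      (S.le_topologicalClosure (S.smul_mem _ hp))
    rw [map_smul, smul_eq_mul, div_mul_cancel₀ _ hne] at h1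
    linarith
  have h0 := hfs 0 (zero_mem _)
  rw [map_zero] at h0
  set a := (InnerProductSpace.toDual ℝ V).symm (f.comp (ContinuousLinearMap.inl ℝ V V))
  set b := (InnerProductSpace.toDual ℝ V).symm (f.comp (ContinuousLinearMap.inr ℝ V V))
  have hrep : ∀ p : V × V, f p = inner ℝ a p.1 + inner ℝ b p.2 := by
    intro p
    rw [InnerProductSpace.toDual_symm_apply, InnerProductSpace.toDual_symm_apply]
    simp only [ContinuousLinearMap.comp_apply, ContinuousLinearMap.inl_apply,
      ContinuousLinearMap.inr_apply, ← map_add]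
    simp
  have := h a b fun p hp => by rw [← hrep, hvan p hp]
  have h2 := hrep (x, y)
  simp only [this] at h2
  linarith

lemma inner_eq_of_ae {v w : VecL2 Ω} {f : E3 → E3} (h : w =ᵐ[volume.restrict Ω] f) :
    inner ℝ v w = ∫ x in Ω, inner ℝ (v x) (f x) := by
  rw [L2.inner_def]
  refine integral_congr_ae ?_
  filter_upwards [h] with x hx
  rw [hx]

/-- Membership in `H(curl)` is orthogonality to the rotated graph of the curl on test fields. -/
lemma isHCurl_iff (v w : VecL2 Ω) :
    IsHCurl Ω v w ↔ ∀ p ∈ testGraph Ω, inner ℝ v p.2 = inner ℝ w p.1 := by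
  constructor
  · rintro h p ⟨φ, hφ, h1, h2⟩
    rw [inner_eq_of_ae h1, inner_eq_of_ae h2]
    exact h φ hφ
  · intro h φ hφ
    have := h _ hφ.mem_testGraph
    rwa [inner_eq_of_ae hφ.memLp.coeFn_toLp, inner_eq_of_ae hφ.memLp_curl.coeFn_toLp] at this

lemma isHCurl_of_mem_testGraph {p : VecL2 Ω × VecL2 Ω} (hp : p ∈ testGraph Ω) :
    IsHCurl Ω p.1 p.2 := by
  obtain ⟨φ, hφ, h1, h2⟩ := hp
  intro ψ hψ
  have e1 : ∫ x in Ω, inner ℝ (p.1 x) (curl ψ x) = ∫ x in Ω, inner ℝ (φ x) (curl ψ x) := by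
    refine integral_congr_ae ?_
    filter_upwards [h1] with x hx
    rw [hx]
  have e2 : ∫ x in Ω, inner ℝ (p.2 x) (ψ x) = ∫ x in Ω, inner ℝ (curl φ x) (ψ x) := by
    refine integral_congr_ae ?_
    filter_upwards [h2] with x hx
    rw [hx]
  rw [e1, e2, integral_inner_curl hφ hψ]

lemma dense_testFields (hΩ : IsOpen Ω) : Dense (Prod.fst '' testGraph Ω : Set (VecL2 Ω)) := by
  set K : Submodule ℝ (VecL2 Ω) := (testSubmodule Ω).map (LinearMap.fst ℝ _ _) with hK
  have hKset : (K : Set (VecL2 Ω)) = Prod.fst '' testGraph Ω := rfl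
  rw [← hKset, Submodule.dense_iff_topologicalClosure_eq_top,
    Submodule.topologicalClosure_eq_top_iff, Submodule.eq_bot_iff]
  intro z hz
  rw [Submodule.mem_orthogonal'] at hz
  have hcoord : ∀ j : Fin 3, ∀ᵐ x ∂(volume : Measure E3), x ∈ Ω → z x j = 0 := by
    intro j
    have hzm : MemLp z 2 (volume.restrict Ω) := Lp.memLp z
    have hloc : LocallyIntegrableOn (fun x => z x j) Ω volume := by
      intro x hx
      refine ⟨Ω ∩ Metric.ball x 1, inter_mem self_mem_nhdsWithin
        (mem_nhdsWithin_of_mem_nhds (Metric.ball_mem_nhds x one_pos)), ?_⟩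
      have h1 : MemLp z 2 (volume.restrict (Ω ∩ Metric.ball x 1)) :=
        hzm.mono_measure (Measure.restrict_mono inter_subset_left le_rfl)
      have : IsFiniteMeasure ((volume : Measure E3).restrict (Ω ∩ Metric.ball x 1)) :=
        ⟨by
          rw [Measure.restrict_apply_univ]
          exact (measure_mono inter_subset_right).trans_lt measure_ball_lt_top⟩
      exact (EuclideanSpace.proj (𝕜 := ℝ) j).integrable_comp (h1.integrable one_le_two)
    refine hΩ.ae_eq_zero_of_integral_contDiff_smul_eq_zero hloc fun g hg hgc hgs => ?_
    set φ : E3 → E3 := fun x => g x • EuclideanSpace.single j (1 : ℝ) with hφdef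
    have hφ : IsTestField Ω φ :=
      ⟨hg.smul contDiff_const, hgc.smul_right, (tsupport_smul_subset_left g _).trans hgs⟩
    have h := hz (hφ.memLp.toLp φ) ⟨_, hφ.mem_testGraph, rfl⟩
    rw [inner_eq_of_ae hφ.memLp.coeFn_toLp] at h
    rw [← setIntegral_eq_integral_of_forall_compl_eq_zero (s := Ω), ← h]
    · refine integral_congr_ae (Eventually.of_forall fun x => ?_)
      simp [hφdef, real_inner_smul_right, EuclideanSpace.inner_single_right]
    · intro x hx
      rw [image_eq_zero_of_notMem_tsupport fun h' => hx (hgs h'), zero_smul]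
  rw [Lp.eq_zero_iff_ae_eq_zero]
  have hall : ∀ᵐ x ∂(volume : Measure E3), x ∈ Ω → z x = 0 := by
    filter_upwards [ae_all_iff.2 hcoord] with x hx hxΩ
    ext j
    exact hx j hxΩ
  exact (ae_restrict_iff' hΩ.measurableSet).2 hall

/-- A weak solution obeys a two-time identity free of the curl: the primitive of `E` lies in
`H₀(curl)`, which makes it an admissible test field in Ampère's law. -/
lemma IsWeakSolution.two_time_identity {T α β εinf Δε : ℝ} {E₀ H₀ : VecL2 Ω} {E H P : ℝ → VecL2 Ω}
    (hsol : IsWeakSolution Ω T α β εinf Δε E₀ H₀ E H P) {s t : ℝ} (hs : s ∈ Icc 0 T)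
    (ht : t ∈ Icc 0 T) :
    inner ℝ (εinf • (E t - E₀) + P t) (∫ r in (0 : ℝ)..s, E r) +
      inner ℝ (∫ r in (0 : ℝ)..t, H r) (H s - H₀) = 0 := by
  have hEi : ∀ r ∈ Icc 0 T, IntervalIntegrable E volume 0 r := fun r hr => by
    rw [intervalIntegrable_iff_integrableOn_Icc_of_le hr.1]
    exact hsol.integrable_E.mono_set (Icc_subset_Icc_right hr.2)
  have hHi : ∀ r ∈ Icc 0 T, IntervalIntegrable H volume 0 r := fun r hr => by
    rw [intervalIntegrable_iff_integrableOn_Icc_of_le hr.1]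
    exact hsol.integrable_H.mono_set (Icc_subset_Icc_right hr.2)
  have hinner : ∀ {f : ℝ → VecL2 Ω} {r : ℝ}, 0 ≤ r → IntervalIntegrable f volume 0 r →
      ∀ w, ∫ q in (0 : ℝ)..r, inner ℝ (f q) w = inner ℝ (∫ q in (0 : ℝ)..r, f q) w := by
    intro f r hr hf w
    simp_rw [real_inner_comm w]
    rw [intervalIntegral.integral_of_le hr, intervalIntegral.integral_of_le hr]
    exact integral_inner hf.1 w
  have hmem : IsH0Curl Ω (∫ r in (0 : ℝ)..s, E r) (-(H s - H₀)) := by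
    refine mem_closure_of_forall_orthogonal (testSubmodule Ω) _ _ fun a b hab => ?_
    have hcurl : IsHCurl Ω b (-a) := by
      rw [isHCurl_iff]
      intro p hp
      have := hab p hp
      rw [inner_neg_left]
      linarith
    have := hsol.faraday b (-a) hcurl s hs
    rw [hinner hs.1 (hEi s hs), inner_neg_right] at this
    rw [inner_neg_right, inner_sub_right, real_inner_comm, real_inner_comm (H s) b,
      real_inner_comm H₀ b]
    linarith
  have := hsol.ampere _ _ hmem t ht
  rw [hinner ht.1 (hHi t ht), inner_neg_right] at this
  rw [inner_add_left, real_inner_smul_left, inner_sub_left]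
  linarith

/-- Tested against a test field, the Ampère and Faraday laws make the fields continuous in time. -/
lemma IsWeakSolution.continuousOn_inner {T α β εinf Δε : ℝ} {E₀ H₀ : VecL2 Ω} {E H P : ℝ → VecL2 Ω}
    (hsol : IsWeakSolution Ω T α β εinf Δε E₀ H₀ E H P) {v : VecL2 Ω}
    (hv : v ∈ Prod.fst '' testGraph Ω) :
    ContinuousOn (fun t => εinf * inner ℝ (E t) v + inner ℝ (P t) v) (Icc 0 T) ∧
      ContinuousOn (fun t => inner ℝ (H t) v) (Icc 0 T) := by
  obtain ⟨p, hp, rfl⟩ := hv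
  have hprim : ∀ {f : ℝ → VecL2 Ω} (w : VecL2 Ω), IntegrableOn f (Icc 0 T) →
      ContinuousOn (fun t => ∫ s in (0 : ℝ)..t, inner ℝ (f s) w) (Icc 0 T) := by
    intro f w hf
    rcases le_or_gt 0 T with hT | hT
    · rw [← uIcc_of_le hT] at hf ⊢
      exact intervalIntegral.continuousOn_primitive_interval (hf.inner_const w)
    · rw [Icc_eq_empty hT.not_ge]
      exact continuousOn_empty _
  constructor
  · refine ContinuousOn.congr (f := fun t => εinf * inner ℝ E₀ p.1 +
      ∫ s in (0 : ℝ)..t, inner ℝ (H s) p.2) (continuousOn_const.add (hprim _ hsol.integrable_H)) ?_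
    exact fun t ht => hsol.ampere p.1 p.2 (subset_closure hp) t ht
  · refine ContinuousOn.congr (f := fun t => inner ℝ H₀ p.1 -
      ∫ s in (0 : ℝ)..t, inner ℝ (E s) p.2) (continuousOn_const.sub (hprim _ hsol.integrable_E)) ?_
    exact fun t ht => hsol.faraday p.1 p.2 (isHCurl_of_mem_testGraph hp) t ht

end

/-! ### Energy bound for time increments -/

section

variable {X : Type*} [NormedAddCommGroup X]

/-- The restriction of a field to `(0, T]`, extended by zero. Time `0` is left out, so that the
extension vanishes at all nonpositive times; a single time does not affect integrals. -/
abbrev cutoff (T : ℝ) (f : ℝ → X) : ℝ → X := (Ioc 0 T).indicator f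

lemma cutoff_of_nonpos (T : ℝ) (f : ℝ → X) {r : ℝ} (hr : r ≤ 0) : cutoff T f r = 0 :=
  indicator_of_notMem (fun h => hr.not_gt h.1) f

lemma cutoff_of_mem {T : ℝ} (f : ℝ → X) {r : ℝ} (hr : r ∈ Ioc 0 T) : cutoff T f r = f r :=
  indicator_of_mem hr f

lemma integrable_cutoff {T : ℝ} {f : ℝ → X} (hf : IntegrableOn f (Icc 0 T)) :
    Integrable (cutoff T f) :=
  (hf.mono_set Ioc_subset_Icc_self).integrable_indicator measurableSet_Ioc

variable [InnerProductSpace ℝ X]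

/-- The weighted Cauchy–Schwarz inequality for the energy inner product. -/
lemma energy_inner_le {ε : ℝ} (hε : 0 ≤ ε) (a b c d : X) :
    ε * inner ℝ a c + inner ℝ b d ≤
      √(ε * ‖a‖ ^ 2 + ‖b‖ ^ 2) * √(ε * ‖c‖ ^ 2 + ‖d‖ ^ 2) := by
  rw [← Real.sqrt_mul (by positivity)]
  refine (?_ : _ ≤ ε * (‖a‖ * ‖c‖) + ‖b‖ * ‖d‖).trans (Real.le_sqrt_of_sq_le ?_)
  · exact add_le_add (mul_le_mul_of_nonneg_left (real_inner_le_norm _ _) hε)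
      (real_inner_le_norm _ _)
  · nlinarith [mul_nonneg hε (sq_nonneg (‖a‖ * ‖d‖ - ‖b‖ * ‖c‖))]

lemma integral_sub_translate {f : ℝ → X} (hf : Integrable f) (hf0 : ∀ r, r ≤ 0 → f r = 0) {δ : ℝ}
    (hδ : 0 ≤ δ) (s : ℝ) :
    ∫ r in (0 : ℝ)..s, (f r - f (r - δ)) =
      (∫ r in (0 : ℝ)..s, f r) - ∫ r in (0 : ℝ)..(s - δ), f r := by
  have h1 : ∫ r in (0 : ℝ)..s, f (r - δ) = ∫ r in (0 : ℝ)..(s - δ), f r := by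
    rw [intervalIntegral.integral_comp_sub_right f,
      ← intervalIntegral.integral_add_adjacent_intervals (b := 0) hf.intervalIntegrable
        hf.intervalIntegrable, intervalIntegral.integral_symm,
      primitive_eq_zero hf0 (by linarith), neg_zero, zero_add]
  rw [intervalIntegral.integral_sub hf.intervalIntegrable
    (hf.comp_sub_right δ).intervalIntegrable, h1]

lemma intervalIntegrable_inner_of_continuous {W U : ℝ → X} (hW : Integrable W) (hU : Continuous U)
    {C : ℝ} (hC : ∀ s, ‖U s‖ ≤ C) (a b : ℝ) :
    IntervalIntegrable (fun s => inner ℝ (W s) (U s)) volume a b := by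
  refine Integrable.intervalIntegrable ?_
  refine (hW.norm.mul_const C).mono' (hW.aestronglyMeasurable.inner hU.aestronglyMeasurable)
    (Eventually.of_forall fun s => ?_)
  exact (norm_inner_le_norm _ _).trans (mul_le_mul_of_nonneg_left (hC _) (norm_nonneg _))

lemma integral_cutoff {T : ℝ} (f : ℝ → X) {s : ℝ} (hs : s ∈ Icc 0 T) :
    ∫ r in (0 : ℝ)..s, cutoff T f r = ∫ r in (0 : ℝ)..s, f r := by
  rw [intervalIntegral.integral_of_le hs.1, intervalIntegral.integral_of_le hs.1]
  exact setIntegral_congr_fun measurableSet_Ioc fun r hr =>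
    cutoff_of_mem f ⟨hr.1, hr.2.trans hs.2⟩

/-- The convolution structure of the memory term carries time differences of the field to time
differences of the polarisation. -/
lemma integral_memory_sub_translate {k : ℝ → ℝ} {f : ℝ → X} (hf0 : ∀ r, r ≤ 0 → f r = 0)
    {δ s : ℝ} (hδ : 0 ≤ δ)
    (hint : ∀ x, x ≤ s → IntervalIntegrable (fun r => k (x - r) • f r) volume 0 x) :
    ∫ r in (0 : ℝ)..s, k (s - r) • (f r - f (r - δ)) =
      (∫ r in (0 : ℝ)..s, k (s - r) • f r) -
        ∫ r in (0 : ℝ)..(s - δ), k (s - δ - r) • f r := by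
  have hzero : ∀ r, r ≤ 0 → k (s - δ - r) • f r = 0 := fun r hr => by rw [hf0 r hr, smul_zero]
  have hneg : IntervalIntegrable (fun r => k (s - δ - r) • f r) volume (-δ) 0 := by
    refine (intervalIntegrable_const (c := (0 : X))).congr fun r hr => ?_
    rw [uIoc_of_le (by linarith)] at hr
    exact (hzero r hr.2).symm
  have hneg0 : ∫ r in (-δ)..0, k (s - δ - r) • f r = 0 := by
    rw [intervalIntegral.integral_symm, primitive_eq_zero hzero (by linarith), neg_zero]
  have hi := hneg.trans (hint (s - δ) (by linarith))
  have hcomp : (fun r => k (s - r) • f (r - δ)) =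
      fun r => (fun q => k (s - δ - q) • f q) (r - δ) := by
    funext r
    simp only
    congr 2
    ring
  have h2i : IntervalIntegrable (fun r => k (s - r) • f (r - δ)) volume 0 s := by
    have := hi.comp_sub_right δ
    rw [hcomp]
    simpa using this
  have h2 : ∫ r in (0 : ℝ)..s, k (s - r) • f (r - δ) =
      ∫ r in (0 : ℝ)..(s - δ), k (s - δ - r) • f r := by
    rw [hcomp, intervalIntegral.integral_comp_sub_right (fun q => k (s - δ - q) • f q), zero_sub,
      ← intervalIntegral.integral_add_adjacent_intervals hneg (hint (s - δ) (by linarith)), hneg0,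
      zero_add]
  simp only [smul_sub]
  rw [intervalIntegral.integral_sub (hint s le_rfl) h2i, h2]

/-- Energy bound for the time increments over a step `δ`. Taking increments in both times of the
two-time identity and setting the times equal gives the energy balance of the averaged fields; the
memory term has a sign, and the initial data act only up to time `δ`. -/
lemma energy_increment_le [CompleteSpace X] {k : ℝ → ℝ} {E H P : ℝ → X} {E₀ H₀ : X} {T ε Δε : ℝ}
    (hε : 0 ≤ ε) (hΔ : 0 ≤ Δε) (hk : AntitoneOn k (Ioi 0)) (hk0 : ∀ x, 0 < x → 0 ≤ k x)
    (hki : IntegrableOn k (Ioc 0 T)) (hE : IntegrableOn E (Icc 0 T)) (hH : IntegrableOn H (Icc 0 T))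
    (hid : ∀ s ∈ Icc 0 T, ∀ t ∈ Icc 0 T,
      inner ℝ (ε • (E t - E₀) + P t) (∫ r in (0 : ℝ)..s, E r) +
        inner ℝ (∫ r in (0 : ℝ)..t, H r) (H s - H₀) = 0)
    (hmem : ∀ t ∈ Ioc 0 T, IntervalIntegrable (fun s => k (t - s) • E s) volume 0 t)
    (hpol : ∀ t ∈ Ioc 0 T, P t = Δε • ∫ s in (0 : ℝ)..t, k (t - s) • E s)
    {δ t : ℝ} (hδ : 0 < δ) (ht : t ∈ Icc 0 T) :
    ε * ‖(∫ r in (0 : ℝ)..t, cutoff T E r) - ∫ r in (0 : ℝ)..(t - δ), cutoff T E r‖ ^ 2 +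
      ‖(∫ r in (0 : ℝ)..t, cutoff T H r) - ∫ r in (0 : ℝ)..(t - δ), cutoff T H r‖ ^ 2 ≤
      δ ^ 2 * (ε * ‖E₀‖ ^ 2 + ‖H₀‖ ^ 2) := by
  have hEi := integrable_cutoff hE
  have hHi := integrable_cutoff hH
  have hE0 : ∀ r, r ≤ 0 → cutoff T E r = 0 := fun r hr => cutoff_of_nonpos T E hr
  have hH0 : ∀ r, r ≤ 0 → cutoff T H r = 0 := fun r hr => cutoff_of_nonpos T H hr
  set u : ℝ → X := fun s => ∫ r in (0 : ℝ)..s, cutoff T E r with hu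
  set h : ℝ → X := fun s => ∫ r in (0 : ℝ)..s, cutoff T H r with hh
  set W : ℝ → X := fun r => cutoff T E r - cutoff T E (r - δ) with hW
  set Z : ℝ → X := fun r => cutoff T H r - cutoff T H (r - δ) with hZ
  have hWi : Integrable W := hEi.sub (hEi.comp_sub_right δ)
  have hZi : Integrable Z := hHi.sub (hHi.comp_sub_right δ)
  have hW0 : ∀ r, r ≤ 0 → W r = 0 := fun r hr => by
    simp only [hW]; rw [hE0 r hr, hE0 (r - δ) (by linarith), sub_zero]
  have hU : ∀ s, ∫ r in (0 : ℝ)..s, W r = u s - u (s - δ) := integral_sub_translate hEi hE0 hδ.le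
  have hV : ∀ s, ∫ r in (0 : ℝ)..s, Z r = h s - h (s - δ) := integral_sub_translate hHi hH0 hδ.le
  set U : ℝ → X := fun s => ∫ r in (0 : ℝ)..s, W r with hUdef
  set V : ℝ → X := fun s => ∫ r in (0 : ℝ)..s, Z r with hVdef
  have hUc : Continuous U := continuous_primitive hWi
  have hVc : Continuous V := continuous_primitive hZi
  change ε * ‖u t - u (t - δ)‖ ^ 2 + ‖h t - h (t - δ)‖ ^ 2 ≤ _
  rw [← hU, ← hV]
  change ε * ‖U t‖ ^ 2 + ‖V t‖ ^ 2 ≤ _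
  -- the two-time identity for the fields extended by zero
  set D : ℝ → X := cutoff T fun r => ε • (E r - E₀) + P r with hD
  set M : ℝ → X := cutoff T fun r => H r - H₀ with hM
  have hid' : ∀ s t, s ≤ T → t ≤ T → inner ℝ (D t) (u s) + inner ℝ (h t) (M s) = 0 := by
    intro s t hs ht
    rcases le_or_gt t 0 with h0 | h0
    · have h1 : D t = 0 := cutoff_of_nonpos T _ h0
      have h2 : h t = 0 := primitive_eq_zero hH0 h0
      rw [h1, h2, inner_zero_left, inner_zero_left, add_zero]
    rcases le_or_gt s 0 with h1 | h1
    · have h2 : u s = 0 := primitive_eq_zero hE0 h1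
      have h3 : M s = 0 := cutoff_of_nonpos T _ h1
      rw [h2, h3, inner_zero_right, inner_zero_right, add_zero]
    have h2 : D t = ε • (E t - E₀) + P t := cutoff_of_mem _ ⟨h0, ht⟩
    have h3 : M s = H s - H₀ := cutoff_of_mem _ ⟨h1, hs⟩
    have h4 : u s = ∫ r in (0 : ℝ)..s, E r := integral_cutoff E ⟨h1.le, hs⟩
    have h5 : h t = ∫ r in (0 : ℝ)..t, H r := integral_cutoff H ⟨h0.le, ht⟩
    rw [h2, h3, h4, h5]
    exact hid s ⟨h1.le, hs⟩ t ⟨h0.le, ht⟩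
  -- its increments in both times, on the diagonal
  have hdiff : ∀ s ≤ T, inner ℝ (D s - D (s - δ)) (U s) + inner ℝ (V s) (M s - M (s - δ)) = 0 := by
    intro s hs
    have h1 := hid' s s hs hs
    have h2 := hid' s (s - δ) hs (by linarith)
    have h3 := hid' (s - δ) s (by linarith) hs
    have h4 := hid' (s - δ) (s - δ) (by linarith) (by linarith)
    have hUs : U s = u s - u (s - δ) := hU s
    have hVs : V s = h s - h (s - δ) := hV s
    rw [hUs, hVs]
    simp only [inner_sub_left, inner_sub_right]
    linarith
  have hmem' : ∀ x ≤ T, IntervalIntegrable (fun r => k (x - r) • cutoff T E r) volume 0 x := by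
    intro x hx
    rcases le_or_gt x 0 with h0 | h0
    · refine (intervalIntegrable_const (c := (0 : X))).congr fun r hr => ?_
      rw [uIoc_of_ge h0] at hr
      rw [hE0 r hr.2, smul_zero]
    · refine (hmem x ⟨h0, hx⟩).congr fun r hr => ?_
      rw [uIoc_of_le h0.le] at hr
      rw [cutoff_of_mem E ⟨hr.1, hr.2.trans hx⟩]
  have hpol' : ∀ x ≤ T, cutoff T P x = Δε • ∫ r in (0 : ℝ)..x, k (x - r) • cutoff T E r := by
    intro x hx
    rcases le_or_gt x 0 with h0 | h0
    · rw [cutoff_of_nonpos T P h0, primitive_eq_zero (fun r hr => by rw [hE0 r hr, smul_zero]) h0,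
        smul_zero]
    · rw [cutoff_of_mem P ⟨h0, hx⟩, hpol x ⟨h0, hx⟩, intervalIntegral.integral_of_le h0.le,
        intervalIntegral.integral_of_le h0.le]
      congr 1
      refine setIntegral_congr_fun measurableSet_Ioc fun r hr => ?_
      rw [cutoff_of_mem E ⟨hr.1, hr.2.trans hx⟩]
  set m : ℝ → X := fun s => ∫ r in (0 : ℝ)..s, k (s - r) • W r with hm
  have hPm : ∀ s ∈ Icc 0 T, cutoff T P s - cutoff T P (s - δ) = Δε • m s := by
    intro s hs
    rw [hpol' s hs.2, hpol' (s - δ) (by linarith [hs.2]), ← smul_sub, hm]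
    congr 1
    exact (integral_memory_sub_translate hE0 hδ.le fun x hx => hmem' x (hx.trans hs.2)).symm
  -- the initial data act on `(0, δ]` only
  set g₀ : ℝ → ℝ := fun s => ε * inner ℝ E₀ (U s) + inner ℝ H₀ (V s) with hg₀
  set g : ℝ → ℝ := (Iic δ).indicator g₀ with hg
  have hDs : ∀ s ∈ Ioc 0 T, D s - D (s - δ) = ε • W s + Δε • m s -
      (Iic δ).indicator (fun _ => ε • E₀) s := by
    intro s hs
    rw [← hPm s (Ioc_subset_Icc_self hs)]
    simp only [hD, hW]
    rw [cutoff_of_mem _ hs, cutoff_of_mem E hs, cutoff_of_mem P hs]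
    rcases le_or_gt s δ with h1 | h1
    · rw [cutoff_of_nonpos T _ (by linarith : s - δ ≤ 0),
        cutoff_of_nonpos T E (by linarith : s - δ ≤ 0),
        cutoff_of_nonpos T P (by linarith : s - δ ≤ 0), indicator_of_mem (show s ∈ Iic δ from h1)]
      module
    · have h2 : s - δ ∈ Ioc 0 T := ⟨by linarith, by linarith [hs.2]⟩
      rw [cutoff_of_mem _ h2, cutoff_of_mem E h2, cutoff_of_mem P h2,
        indicator_of_notMem (show s ∉ Iic δ from h1.not_ge)]
      module
  have hMs : ∀ s ∈ Ioc 0 T, M s - M (s - δ) = Z s - (Iic δ).indicator (fun _ => H₀) s := by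
    intro s hs
    simp only [hM, hZ]
    rw [cutoff_of_mem _ hs, cutoff_of_mem H hs]
    rcases le_or_gt s δ with h1 | h1
    · rw [cutoff_of_nonpos T _ (by linarith : s - δ ≤ 0),
        cutoff_of_nonpos T H (by linarith : s - δ ≤ 0), indicator_of_mem (show s ∈ Iic δ from h1)]
      module
    · have h2 : s - δ ∈ Ioc 0 T := ⟨by linarith, by linarith [hs.2]⟩
      rw [cutoff_of_mem _ h2, cutoff_of_mem H h2,
        indicator_of_notMem (show s ∉ Iic δ from h1.not_ge)]
      module
  have hbal : ∀ s ∈ Ioc 0 T, Δε * inner ℝ (m s) (U s) =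
      g s - ε * inner ℝ (W s) (U s) - inner ℝ (Z s) (V s) := by
    intro s hs
    have h1 := hdiff s hs.2
    rw [hDs s hs, hMs s hs] at h1
    simp only [hg]
    by_cases h2 : s ∈ Iic δ
    · rw [indicator_of_mem h2, indicator_of_mem h2] at h1
      rw [indicator_of_mem h2]
      simp only [inner_sub_left, inner_sub_right, inner_add_left, real_inner_smul_left] at h1
      rw [real_inner_comm (Z s) (V s), real_inner_comm H₀ (V s)] at h1
      simp only [hg₀]
      linarith
    · rw [indicator_of_notMem h2, indicator_of_notMem h2] at h1
      rw [indicator_of_notMem h2]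
      simp only [sub_zero, inner_add_left, real_inner_smul_left] at h1
      rw [real_inner_comm (Z s) (V s)] at h1
      linarith
  have hg₀c : Continuous g₀ := by simp only [hg₀]; fun_prop
  have hgi : ∀ a b, IntervalIntegrable g volume a b := fun a b =>
    ⟨(hg₀c.intervalIntegrable a b).1.indicator measurableSet_Iic,
      (hg₀c.intervalIntegrable a b).2.indicator measurableSet_Iic⟩
  have hWU := intervalIntegrable_inner_of_continuous hWi hUc (norm_primitive_le hWi)
  have hZV := intervalIntegrable_inner_of_continuous hZi hVc (norm_primitive_le hZi)
  -- integrate the balance and drop the memory term, which is nonnegative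
  have henergy : ∀ s ∈ Icc 0 T, ε * ‖U s‖ ^ 2 + ‖V s‖ ^ 2 ≤ 2 * ∫ r in (0 : ℝ)..s, g r := by
    intro s hs
    have h1 := integral_memory_inner_nonneg hs.1 hk hk0
      (hki.mono_set (Ioc_subset_Ioc_right hs.2)) hWi hW0
    have h2 : ∫ r in (0 : ℝ)..s, Δε * inner ℝ (m r) (U r) =
        ∫ r in (0 : ℝ)..s, (g r - ε * inner ℝ (W r) (U r) - inner ℝ (Z r) (V r)) := by
      rw [intervalIntegral.integral_of_le hs.1, intervalIntegral.integral_of_le hs.1]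
      exact setIntegral_congr_fun measurableSet_Ioc fun r hr => hbal r ⟨hr.1, hr.2.trans hs.2⟩
    rw [intervalIntegral.integral_const_mul, intervalIntegral.integral_sub
      ((hgi 0 s).sub ((hWU 0 s).const_mul ε)) (hZV 0 s), intervalIntegral.integral_sub (hgi 0 s)
      ((hWU 0 s).const_mul ε), intervalIntegral.integral_const_mul,
      integral_inner_primitive hWi hs.1, integral_inner_primitive hZi hs.1] at h2
    have h3 := mul_nonneg hΔ h1
    change 0 ≤ Δε * ∫ r in (0 : ℝ)..s, inner ℝ (m r) (U r) at h3
    change _ = (∫ r in (0 : ℝ)..s, g r) - ε * (1 / 2 * ‖U s‖ ^ 2) - 1 / 2 * ‖V s‖ ^ 2 at h2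
    linarith
  set n : ℝ → ℝ := fun s => √(ε * ‖U s‖ ^ 2 + ‖V s‖ ^ 2) with hn
  set n₀ : ℝ := √(ε * ‖E₀‖ ^ 2 + ‖H₀‖ ^ 2) with hn₀
  have hnc : Continuous n := by simp only [hn]; fun_prop
  have hnsq : ∀ s, n s ^ 2 = ε * ‖U s‖ ^ 2 + ‖V s‖ ^ 2 := fun s => Real.sq_sqrt (by positivity)
  have hn₀sq : n₀ ^ 2 = ε * ‖E₀‖ ^ 2 + ‖H₀‖ ^ 2 := Real.sq_sqrt (by positivity)
  have hgn : ∀ s, g₀ s ≤ n₀ * n s := fun s => energy_inner_le hε _ _ _ _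
  have hgsmall : ∀ s ∈ Icc 0 δ, ∫ r in (0 : ℝ)..s, g r ≤ n₀ * ∫ r in (0 : ℝ)..s, n r := by
    intro s hs
    rw [← intervalIntegral.integral_const_mul]
    refine intervalIntegral.integral_mono_on hs.1 (hgi _ _)
      ((hnc.intervalIntegrable _ _).const_mul _) fun r hr => ?_
    simp only [hg]
    rw [indicator_of_mem (show r ∈ Iic δ from hr.2.trans hs.2)]
    exact hgn r
  have hgron : ∀ s ∈ Icc 0 (min δ T), n s ≤ n₀ * s := fun s hs =>
    le_mul_of_sq_le_integral hnc (fun _ => Real.sqrt_nonneg _) (Real.sqrt_nonneg _)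
      (fun r hr => by
        rw [hnsq, mul_assoc]
        exact (henergy r ⟨hr.1, hr.2.trans (min_le_right _ _)⟩).trans
          (mul_le_mul_of_nonneg_left (hgsmall r ⟨hr.1, hr.2.trans (min_le_left _ _)⟩) two_pos.le))
      hs
  rw [← hnsq, ← hn₀sq]
  rcases le_or_gt t δ with htδ | htδ
  · have h1 := hgron t ⟨ht.1, le_min htδ ht.2⟩
    have h2 : n t ≤ δ * n₀ := by
      rw [mul_comm]
      exact h1.trans (mul_le_mul_of_nonneg_left htδ (Real.sqrt_nonneg _))
    rw [← mul_pow]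
    exact pow_le_pow_left₀ (Real.sqrt_nonneg _) h2 2
  · have h1 := henergy t ht
    have h2 : ∫ r in δ..t, g r = 0 := by
      rw [intervalIntegral.integral_of_le htδ.le]
      refine setIntegral_eq_zero_of_forall_eq_zero fun r hr => ?_
      simp only [hg]
      exact indicator_of_notMem (show r ∉ Iic δ from fun h => hr.1.not_ge h) _
    have h3 := intervalIntegral.integral_add_adjacent_intervals (hgi 0 δ) (hgi δ t)
    have h4 := hgsmall δ ⟨hδ.le, le_rfl⟩
    have h5 : ∫ r in (0 : ℝ)..δ, n r ≤ ∫ r in (0 : ℝ)..δ, n₀ * r := by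
      refine intervalIntegral.integral_mono_on hδ.le (hnc.intervalIntegrable _ _)
        (Continuous.intervalIntegrable (by fun_prop) _ _) fun r hr => ?_
      exact hgron r ⟨hr.1, hr.2.trans (le_min le_rfl (htδ.le.trans ht.2))⟩
    rw [intervalIntegral.integral_const_mul, integral_id] at h5
    have h6 := mul_le_mul_of_nonneg_left h5 (Real.sqrt_nonneg (ε * ‖E₀‖ ^ 2 + ‖H₀‖ ^ 2))
    rw [hnsq]
    change n₀ * _ ≤ n₀ * _ at h6
    nlinarith

end

/-! ### Passage to pointwise bounds -/

section

variable {X : Type*} [NormedAddCommGroup X] [InnerProductSpace ℝ X]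

/-- By Lebesgue differentiation, bounds on time increments pass to the fields almost everywhere. -/
lemma ae_energy_le [CompleteSpace X] {E H : ℝ → X} (hE : Integrable E) (hH : Integrable H)
    {T ε c : ℝ}
    (h : ∀ δ > 0, ∀ t ∈ Ioc 0 T,
      ε * ‖(∫ r in (0 : ℝ)..t, E r) - ∫ r in (0 : ℝ)..(t - δ), E r‖ ^ 2 +
        ‖(∫ r in (0 : ℝ)..t, H r) - ∫ r in (0 : ℝ)..(t - δ), H r‖ ^ 2 ≤ δ ^ 2 * c) :
    ∀ᵐ t, t ∈ Ioc 0 T → ε * ‖E t‖ ^ 2 + ‖H t‖ ^ 2 ≤ c := by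
  have hlim : ∀ {f : ℝ → X} {t : ℝ}, HasDerivAt (fun x => ∫ r in (0 : ℝ)..x, f r) (f t) t →
      Tendsto (fun δ : ℝ => ‖(∫ r in (0 : ℝ)..t, f r) - ∫ r in (0 : ℝ)..(t - δ), f r‖ ^ 2 / δ ^ 2)
        (𝓝[>] 0) (𝓝 (‖f t‖ ^ 2)) := by
    intro f t hf
    have h1 : Tendsto (fun δ : ℝ => -δ) (𝓝[>] 0) (𝓝[≠] 0) := by
      refine tendsto_nhdsWithin_iff.2 ⟨?_, ?_⟩
      · exact (Continuous.tendsto' continuous_neg 0 0 neg_zero).mono_left nhdsWithin_le_nhds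
      · filter_upwards [self_mem_nhdsWithin] with δ hδ
        exact neg_ne_zero.2 (ne_of_gt hδ)
    have h2 := ((hf.tendsto_slope_zero.comp h1).norm).pow 2
    refine h2.congr' ?_
    filter_upwards [self_mem_nhdsWithin] with δ hδ
    have hδ : 0 < δ := hδ
    simp only [Function.comp, ← sub_eq_add_neg]
    rw [norm_smul, mul_pow, norm_sub_rev, norm_inv, norm_neg, Real.norm_of_nonneg hδ.le, inv_pow]
    field_simp
  filter_upwards [_root_.LocallyIntegrable.ae_hasDerivAt_integral hE.locallyIntegrable,
    _root_.LocallyIntegrable.ae_hasDerivAt_integral hH.locallyIntegrable] with t ht1 ht2 ht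
  refine le_of_tendsto (((hlim (ht1 0)).const_mul ε).add (hlim (ht2 0))) ?_
  filter_upwards [self_mem_nhdsWithin] with δ hδ
  have hδ : 0 < δ := hδ
  rw [← mul_div_assoc, ← add_div, div_le_iff₀ (by positivity), mul_comm c]
  exact h δ hδ t ht

section Memory

variable {k : ℝ → ℝ} {T : ℝ}

lemma intervalIntegrable_kernel (hki : IntegrableOn k (Ioc 0 T)) {a b : ℝ} (ha : 0 ≤ a)
    (hab : a ≤ b) (hb : b ≤ T) : IntervalIntegrable k volume a b := by
  rw [intervalIntegrable_iff_integrableOn_Ioc_of_le hab]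
  exact hki.mono_set (Ioc_subset_Ioc ha hb)

lemma integral_kernel_reflect (a b s : ℝ) :
    ∫ r in a..b, k (s - r) = ∫ r in (s - b)..(s - a), k r :=
  intervalIntegral.integral_comp_sub_left k s

lemma intervalIntegrable_kernel_reflect (hki : IntegrableOn k (Ioc 0 T)) {a b s : ℝ} (hab : a ≤ b)
    (hbs : b ≤ s) (has : s - a ≤ T) : IntervalIntegrable (fun r => k (s - r)) volume a b := by
  have := (intervalIntegrable_kernel hki (a := s - b) (b := s - a) (by linarith) (by linarith)
    has).comp_sub_left s
  simpa using this.symm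

/-- Young's inequality for the memory term with a bounded field. -/
lemma norm_memory_le (hk0 : ∀ x, 0 < x → 0 ≤ k x) (hki : IntegrableOn k (Ioc 0 T)) {f : ℝ → X}
    {C : ℝ} (hC : 0 ≤ C) (hf : ∀ᵐ r, r ∈ Ioc 0 T → ‖f r‖ ≤ C) {s : ℝ} (hs : s ∈ Ioc 0 T) :
    ‖∫ r in (0 : ℝ)..s, k (s - r) • f r‖ ≤ C * ∫ r in (0 : ℝ)..T, k r := by
  have h1 : ‖∫ r in (0 : ℝ)..s, k (s - r) • f r‖ ≤ ∫ r in (0 : ℝ)..s, k (s - r) * C := by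
    refine intervalIntegral.norm_integral_le_of_norm_le hs.1.le ?_
      ((intervalIntegrable_kernel_reflect hki hs.1.le le_rfl (by linarith [hs.2])).mul_const C)
    filter_upwards [hf, Measure.ae_ne volume s] with r hr hrs hrm
    have hkr := hk0 (s - r) (sub_pos.2 (lt_of_le_of_ne hrm.2 hrs))
    rw [norm_smul, Real.norm_of_nonneg hkr]
    exact mul_le_mul_of_nonneg_left (hr ⟨hrm.1, hrm.2.trans hs.2⟩) hkr
  refine h1.trans ?_
  rw [intervalIntegral.integral_mul_const, integral_kernel_reflect, sub_self, sub_zero, mul_comm]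
  refine mul_le_mul_of_nonneg_left ?_ hC
  rw [← intervalIntegral.integral_add_adjacent_intervals (b := s)
    (intervalIntegrable_kernel hki le_rfl hs.1.le hs.2)
    (intervalIntegrable_kernel hki hs.1.le hs.2 le_rfl)]
  refine le_add_of_nonneg_right ?_
  rw [intervalIntegral.integral_of_le hs.2]
  exact setIntegral_nonneg measurableSet_Ioc fun r hr => hk0 r (hs.1.trans hr.1)

/-- Modulus of continuity of the memory term with a bounded field and a nonincreasing kernel. The
increments of the kernel have a sign, so that their integral telescopes. -/
lemma norm_memory_sub_le (hk : AntitoneOn k (Ioi 0)) (hk0 : ∀ x, 0 < x → 0 ≤ k x)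
    (hki : IntegrableOn k (Ioc 0 T)) {f : ℝ → X} {C : ℝ} (hC : 0 ≤ C)
    (hf : ∀ᵐ r, r ∈ Ioc 0 T → ‖f r‖ ≤ C)
    (hint : ∀ t ∈ Ioc 0 T, IntervalIntegrable (fun r => k (t - r) • f r) volume 0 t)
    {s t : ℝ} (hs : 0 < s) (hst : s ≤ t) (ht : t ≤ T) :
    ‖(∫ r in (0 : ℝ)..t, k (t - r) • f r) - ∫ r in (0 : ℝ)..s, k (s - r) • f r‖ ≤
      2 * C * ∫ r in (0 : ℝ)..(t - s), k r := by
  have ht0 : 0 < t := hs.trans_le hst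
  have hit := hint t ⟨ht0, ht⟩
  have his := hint s ⟨hs, hst.trans ht⟩
  have hit1 : IntervalIntegrable (fun r => k (t - r) • f r) volume 0 s :=
    hit.mono_set (by
      rw [uIcc_of_le hs.le, uIcc_of_le ht0.le]; exact Icc_subset_Icc_right hst)
  have hit2 : IntervalIntegrable (fun r => k (t - r) • f r) volume s t :=
    hit.mono_set (by
      rw [uIcc_of_le hst, uIcc_of_le ht0.le]; exact Icc_subset_Icc_left hs.le)
  have hkt := intervalIntegrable_kernel_reflect hki hs.le hst (by linarith : t - 0 ≤ T)
  have hks := intervalIntegrable_kernel_reflect hki hs.le le_rfl (by linarith : s - 0 ≤ T)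
  have hkt2 := intervalIntegrable_kernel_reflect hki hst le_rfl (by linarith : t - s ≤ T)
  have hsplit : (∫ r in (0 : ℝ)..t, k (t - r) • f r) - ∫ r in (0 : ℝ)..s, k (s - r) • f r =
      (∫ r in (0 : ℝ)..s, (k (t - r) • f r - k (s - r) • f r)) +
        ∫ r in s..t, k (t - r) • f r := by
    rw [← intervalIntegral.integral_add_adjacent_intervals hit1 hit2,
      intervalIntegral.integral_sub hit1 his]
    abel
  have h1 : ‖∫ r in (0 : ℝ)..s, (k (t - r) • f r - k (s - r) • f r)‖ ≤
      ∫ r in (0 : ℝ)..s, (k (s - r) - k (t - r)) * C := by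
    refine intervalIntegral.norm_integral_le_of_norm_le hs.le ?_ ((hks.sub hkt).mul_const C)
    filter_upwards [hf, Measure.ae_ne volume s] with r hr hrs hrm
    have hrs' : r < s := lt_of_le_of_ne hrm.2 hrs
    have hle : k (t - r) ≤ k (s - r) :=
      hk (show s - r ∈ Ioi 0 from sub_pos.2 hrs') (show t - r ∈ Ioi 0 from sub_pos.2
        (hrs'.trans_le hst)) (by linarith)
    rw [← sub_smul, norm_smul, norm_sub_rev, Real.norm_of_nonneg (sub_nonneg.2 hle)]
    exact mul_le_mul_of_nonneg_left (hr ⟨hrm.1, hrm.2.trans (hst.trans ht)⟩) (sub_nonneg.2 hle)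
  have h2 : ‖∫ r in s..t, k (t - r) • f r‖ ≤ ∫ r in s..t, k (t - r) * C := by
    refine intervalIntegral.norm_integral_le_of_norm_le hst ?_ (hkt2.mul_const C)
    filter_upwards [hf, Measure.ae_ne volume t] with r hr hrs hrm
    have hkr := hk0 (t - r) (sub_pos.2 (lt_of_le_of_ne hrm.2 hrs))
    rw [norm_smul, Real.norm_of_nonneg hkr]
    exact mul_le_mul_of_nonneg_left (hr ⟨hs.trans hrm.1, hrm.2.trans ht⟩) hkr
  rw [intervalIntegral.integral_mul_const, intervalIntegral.integral_sub hks hkt,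
    integral_kernel_reflect, integral_kernel_reflect, sub_self, sub_zero, sub_zero] at h1
  rw [intervalIntegral.integral_mul_const, integral_kernel_reflect, sub_self] at h2
  have h3 := intervalIntegral.integral_add_adjacent_intervals
    (intervalIntegrable_kernel hki le_rfl (sub_nonneg.2 hst) (by linarith))
    (intervalIntegrable_kernel hki (sub_nonneg.2 hst) (by linarith : t - s ≤ t) ht)
  have h4 := intervalIntegral.integral_add_adjacent_intervals
    (intervalIntegrable_kernel hki le_rfl hs.le (hst.trans ht))
    (intervalIntegrable_kernel hki hs.le hst ht)
  have h5 : 0 ≤ ∫ r in s..t, k r := by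
    rw [intervalIntegral.integral_of_le hst]
    exact setIntegral_nonneg measurableSet_Ioc fun r hr => hk0 r (hs.trans hr.1)
  rw [hsplit]
  refine (norm_add_le _ _).trans ((add_le_add h1 h2).trans ?_)
  rw [← add_mul, mul_comm (2 : ℝ) C, mul_assoc, mul_comm _ C]
  refine mul_le_mul_of_nonneg_left ?_ hC
  linarith

lemma tendsto_integral_kernel (hT : 0 < T) (hki : IntegrableOn k (Ioc 0 T)) (t : ℝ) :
    Tendsto (fun r => ∫ x in (0 : ℝ)..(r - t), k x) (𝓝[>] t) (𝓝 0) := by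
  have hc := intervalIntegral.continuousOn_primitive_interval' (a := 0)
    (intervalIntegrable_kernel hki le_rfl hT.le le_rfl) left_mem_uIcc
  rw [uIcc_of_le hT.le] at hc
  have h0 := hc 0 ⟨le_rfl, hT.le⟩
  have h1 : Tendsto (fun r => r - t) (𝓝[>] t) (𝓝[Icc 0 T] 0) := by
    refine tendsto_nhdsWithin_iff.2 ⟨?_, ?_⟩
    · exact (Continuous.tendsto' (continuous_id.sub continuous_const) t 0 (sub_self t)).mono_left
        nhdsWithin_le_nhds
    · filter_upwards [Ioc_mem_nhdsGT (show t < t + T by linarith)] with r hr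
      exact ⟨by linarith [hr.1], by linarith [hr.2]⟩
  have := h0.tendsto.comp h1
  rw [intervalIntegral.integral_same] at this
  exact this

end Memory

lemma frequently_nhdsGT_of_ae {p : ℝ → Prop} (hp : ∀ᵐ x, p x) (t : ℝ) : ∃ᶠ x in 𝓝[>] t, p x := by
  intro hcon
  obtain ⟨b, hb, hsub⟩ := (mem_nhdsGT_iff_exists_Ioo_subset).1 hcon
  have hz : volume (Ioo t b) = 0 :=
    measure_mono_null (fun x hx => hsub hx) hp
  rw [Real.volume_Ioo, ENNReal.ofReal_eq_zero] at hz
  linarith [mem_Ioi.1 hb]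

/-- Weak continuity upgrades the almost-everywhere energy bound to every time. -/
lemma energy_le_of_ae {E H P : ℝ → X} {T ε c : ℝ} (hε : 0 ≤ ε) (hc : 0 ≤ c) {D : Set X}
    (hD : Dense D)
    (hcE : ∀ v ∈ D, ContinuousOn (fun t => ε * inner ℝ (E t) v + inner ℝ (P t) v) (Icc 0 T))
    (hcH : ∀ v ∈ D, ContinuousOn (fun t => inner ℝ (H t) v) (Icc 0 T))
    (hae : ∀ᵐ t, t ∈ Ioc 0 T → ε * ‖E t‖ ^ 2 + ‖H t‖ ^ 2 ≤ c) {t : ℝ} (ht : t ∈ Ioo 0 T)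
    (hP : Tendsto P (𝓝[>] t) (𝓝 (P t))) : ε * ‖E t‖ ^ 2 + ‖H t‖ ^ 2 ≤ c := by
  have hIcc : Ioc t T ∈ 𝓝[>] t := Ioc_mem_nhdsGT ht.2
  have hle : 𝓝[>] t ≤ 𝓝[Icc 0 T] t := by
    rw [nhdsWithin_le_iff]
    filter_upwards [hIcc] with s hs using ⟨ht.1.le.trans hs.1.le, hs.2⟩
  have htm : t ∈ Icc 0 T := ⟨ht.1.le, ht.2.le⟩
  have hdense : ∀ v ∈ D, ∀ w ∈ D, ε * inner ℝ (E t) v + inner ℝ (H t) w ≤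
      √c * √(ε * ‖v‖ ^ 2 + ‖w‖ ^ 2) := by
    intro v hv w hw
    have h1 := ((hcE v hv) t htm).tendsto.mono_left hle
    have h2 := ((hcH w hw) t htm).tendsto.mono_left hle
    have h3 : Tendsto (fun s => inner ℝ (P s) v) (𝓝[>] t) (𝓝 (inner ℝ (P t) v)) :=
      hP.inner tendsto_const_nhds
    have h4 := (h1.sub h3).add h2
    rw [add_sub_cancel_right] at h4
    -- times at which the energy bound is known accumulate at `t`
    refine le_of_tendsto_of_frequently h4 ?_
    refine ((frequently_nhdsGT_of_ae hae t).and_eventually hIcc).mono fun s hs => ?_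
    have h5 := hs.1 ⟨ht.1.trans hs.2.1, hs.2.2⟩
    rw [add_sub_cancel_right]
    exact (energy_inner_le hε _ _ _ _).trans
      (mul_le_mul_of_nonneg_right (Real.sqrt_le_sqrt h5) (Real.sqrt_nonneg _))
  have hall : ∀ p : X × X, ε * inner ℝ (E t) p.1 + inner ℝ (H t) p.2 ≤
      √c * √(ε * ‖p.1‖ ^ 2 + ‖p.2‖ ^ 2) := by
    intro p
    have hcl : IsClosed {p : X × X | ε * inner ℝ (E t) p.1 + inner ℝ (H t) p.2 ≤
        √c * √(ε * ‖p.1‖ ^ 2 + ‖p.2‖ ^ 2)} := isClosed_le (by fun_prop) (by fun_prop)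
    exact closure_minimal (fun q hq => hdense q.1 hq.1 q.2 hq.2) hcl ((hD.prod hD) p)
  have h := hall (E t, H t)
  simp only [real_inner_self_eq_norm_sq] at h
  set y := ε * ‖E t‖ ^ 2 + ‖H t‖ ^ 2 with hy
  have hy0 : 0 ≤ y := by positivity
  by_contra! hcon
  have h1 := Real.sqrt_lt_sqrt hc hcon
  have h2 : 0 < √y := Real.sqrt_pos.2 (hc.trans_lt hcon)
  have h3 := Real.mul_self_sqrt hy0
  nlinarith

end

end HNMaxwell

end

theorem theorem2p1 (Ω : Set HNMaxwell.E3) (hΩ : IsOpen Ω) (T α β εs εinf : ℝ) (hT : 0 < T)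
    (hα : 0 < α) (hα' : α ≤ 1) (hβ : 0 < β) (hβ' : β ≤ 1) (hεinf : 1 ≤ εinf) (hεs : εinf < εs)
    (E₀ H₀ : HNMaxwell.VecL2 Ω) (E H P : ℝ → HNMaxwell.VecL2 Ω)
    (hsol : HNMaxwell.IsWeakSolution Ω T α β εinf (εs - εinf) E₀ H₀ E H P) :
    (MemLp E ∞ (volume.restrict (Ioo 0 T)) ∧ MemLp H ∞ (volume.restrict (Ioo 0 T)) ∧
      MemLp P ∞ (volume.restrict (Ioo 0 T))) ∧
    (∀ t ∈ Ioo 0 T, εinf * ‖E t‖ ^ 2 + ‖H t‖ ^ 2 ≤ εinf * ‖E₀‖ ^ 2 + ‖H₀‖ ^ 2) ∧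
    Summable (HNMaxwell.boundTerm α β T) ∧
    eLpNorm P ∞ (volume.restrict (Ioo 0 T)) ≤
      ENNReal.ofReal ((εs - εinf) * HNMaxwell.boundConst α β T) *
        eLpNorm E ∞ (volume.restrict (Ioo 0 T)) := by
  open HNMaxwell Filter Topology in
  set k : ℝ → ℝ := prabhakarKernel α (α * β) β (-1) with hkdef
  have hkeq : ∀ x, 0 < x → k x = hnKernel α β x := fun x hx => prabhakarKernel_eq_hnKernel α β hx
  have hk : AntitoneOn k (Ioi 0) := by
    intro x hx y hy hxy
    rw [hkeq x hx, hkeq y hy]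
    exact antitoneOn_hnKernel hα hα' hβ hβ' hx hy hxy
  have hk0 : ∀ x, 0 < x → 0 ≤ k x := fun x hx => by
    rw [hkeq x hx]
    exact (hnKernel_pos hα hα' hβ (by linarith) hx).le
  have hki : IntegrableOn k (Ioc 0 T) :=
    (intervalIntegrable_fracSeries (abs_signedCoeff_le hβ (by linarith : β ≤ 2)) hα
      (mul_pos hα hβ) hT.le).1.congr_fun (fun x hx => (hkeq x hx.1).symm) measurableSet_Ioc
  have hkB : ∫ x in (0 : ℝ)..T, k x ≤ boundConst α β T := by
    refine le_trans (le_of_eq ?_) (integral_hnKernel_le hα hβ hβ' hT)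
    rw [intervalIntegral.integral_of_le hT.le, intervalIntegral.integral_of_le hT.le]
    exact setIntegral_congr_fun measurableSet_Ioc fun x hx => hkeq x hx.1
  have hε : 0 < εinf := by linarith
  have hΔ : 0 ≤ εs - εinf := by linarith
  set c := εinf * ‖E₀‖ ^ 2 + ‖H₀‖ ^ 2 with hc
  have hc0 : 0 ≤ c := by positivity
  have hae : ∀ᵐ t, t ∈ Ioc 0 T → εinf * ‖E t‖ ^ 2 + ‖H t‖ ^ 2 ≤ c := by
    have h := ae_energy_le (T := T) (integrable_cutoff hsol.integrable_E)
      (integrable_cutoff hsol.integrable_H) fun δ hδ t ht =>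
        energy_increment_le hε.le hΔ hk hk0 hki hsol.integrable_E hsol.integrable_H
          (fun s hs t ht => hsol.two_time_identity hs ht) hsol.integrable_memory
          hsol.polarisation hδ (Ioc_subset_Icc_self ht)
    filter_upwards [h] with t ht htm
    have := ht htm
    rwa [cutoff_of_mem E htm, cutoff_of_mem H htm] at this
  have hEb : ∀ᵐ r, r ∈ Ioc 0 T → ‖E r‖ ≤ √c := by
    filter_upwards [hae] with t ht htm
    refine Real.le_sqrt_of_sq_le ?_
    nlinarith [ht htm, sq_nonneg ‖H t‖, sq_nonneg ‖E t‖]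
  have hPt : ∀ t ∈ Ioo 0 T, Tendsto P (𝓝[>] t) (𝓝 (P t)) := by
    intro t ht
    rw [tendsto_iff_norm_sub_tendsto_zero]
    have hlim := (tendsto_integral_kernel hT hki t).const_mul ((εs - εinf) * (2 * √c))
    rw [mul_zero] at hlim
    refine squeeze_zero' (Eventually.of_forall fun _ => norm_nonneg _) ?_ hlim
    filter_upwards [Ioc_mem_nhdsGT ht.2] with s hs
    rw [hsol.polarisation s ⟨ht.1.trans hs.1, hs.2⟩, hsol.polarisation t ⟨ht.1, ht.2.le⟩,
      ← smul_sub, norm_smul, Real.norm_of_nonneg hΔ, mul_assoc]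
    exact mul_le_mul_of_nonneg_left (norm_memory_sub_le hk hk0 hki (Real.sqrt_nonneg _) hEb
      hsol.integrable_memory ht.1 hs.1.le hs.2) hΔ
  have hall : ∀ t ∈ Ioo 0 T, εinf * ‖E t‖ ^ 2 + ‖H t‖ ^ 2 ≤ c := fun t ht =>
    energy_le_of_ae hε.le hc0 (dense_testFields hΩ) (fun v hv => (hsol.continuousOn_inner hv).1)
      (fun v hv => (hsol.continuousOn_inner hv).2) hae ht (hPt t ht)
  have hPb : ∀ C, 0 ≤ C → (∀ᵐ r, r ∈ Ioc 0 T → ‖E r‖ ≤ C) →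
      ∀ t ∈ Ioo 0 T, ‖P t‖ ≤ (εs - εinf) * boundConst α β T * C := by
    intro C hC hE t ht
    rw [hsol.polarisation t ⟨ht.1, ht.2.le⟩, norm_smul, Real.norm_of_nonneg hΔ, mul_assoc]
    refine mul_le_mul_of_nonneg_left ?_ hΔ
    refine (norm_memory_le hk0 hki hC hE ⟨ht.1, ht.2.le⟩).trans ?_
    rw [mul_comm]
    exact mul_le_mul_of_nonneg_right hkB hC
  have hmeas : ∀ {f : ℝ → VecL2 Ω}, IntegrableOn f (Icc 0 T) →
      AEStronglyMeasurable f (volume.restrict (Ioo 0 T)) := fun hf =>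
    (hf.mono_set Ioo_subset_Icc_self).aestronglyMeasurable
  have hME : MemLp E ∞ (volume.restrict (Ioo 0 T)) := by
    refine memLp_top_of_bound (hmeas hsol.integrable_E) √c ?_
    filter_upwards [ae_restrict_of_ae hEb, ae_restrict_mem measurableSet_Ioo] with t ht htm
    exact ht (Ioo_subset_Ioc_self htm)
  have hMH : MemLp H ∞ (volume.restrict (Ioo 0 T)) := by
    refine memLp_top_of_bound (hmeas hsol.integrable_H) √c ?_
    filter_upwards [ae_restrict_mem measurableSet_Ioo] with t ht
    refine Real.le_sqrt_of_sq_le ?_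
    nlinarith [hall t ht, mul_nonneg hε.le (sq_nonneg ‖E t‖)]
  have hMP : MemLp P ∞ (volume.restrict (Ioo 0 T)) := by
    refine memLp_top_of_bound (hmeas hsol.integrable_P) ((εs - εinf) * boundConst α β T * √c) ?_
    filter_upwards [ae_restrict_mem measurableSet_Ioo] with t ht
    exact hPb √c (Real.sqrt_nonneg _) hEb t ht
  refine ⟨⟨hME, hMH, hMP⟩, hall, summable_boundTerm hα hβ hβ' hT, ?_⟩
  -- the essential supremum of `E` is itself an almost-everywhere bound
  set N := (eLpNorm E ∞ (volume.restrict (Ioo 0 T))).toReal with hN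
  have hNb : ∀ᵐ r, r ∈ Ioc 0 T → ‖E r‖ ≤ N := by
    have h := ae_le_eLpNormEssSup (f := E) (μ := volume.restrict (Ioo 0 T))
    rw [ae_restrict_iff' measurableSet_Ioo] at h
    filter_upwards [h, Measure.ae_ne volume T] with r hr hrT hrm
    have h1 := hr ⟨hrm.1, lt_of_le_of_ne hrm.2 hrT⟩
    rw [← eLpNorm_exponent_top] at h1
    have h2 := ENNReal.toReal_mono hME.2.ne h1
    rwa [toReal_enorm] at h2
  have hB0 : 0 ≤ boundConst α β T := by
    refine le_trans ?_ hkB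
    rw [intervalIntegral.integral_of_le hT.le]
    exact setIntegral_nonneg measurableSet_Ioc fun x hx => hk0 x hx.1
  have hfin : eLpNorm E ∞ (volume.restrict (Ioo 0 T)) = ENNReal.ofReal N :=
    (ENNReal.ofReal_toReal hME.2.ne).symm
  rw [hfin, ← ENNReal.ofReal_mul (mul_nonneg hΔ hB0), eLpNorm_exponent_top]
  refine eLpNormEssSup_le_of_ae_bound ?_
  filter_upwards [ae_restrict_mem measurableSet_Ioo] with t ht
  exact hPb N ENNReal.toReal_nonneg hNb t ht
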